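/- Let $\Bbbk$ be an algebraically closed field (of any characteristic), let $G$ be an affine algebraic group over $\Bbbk$, not necessarily connected, and let $H\subseteq G$ be a Zariski-closed subgroup. Write $\Bbbk[G]$ for the algebra of polynomial functions on $G$, and $\Bbbk[H]$ for the algebra of their restrictions to $H$. A rational $G$-module is a $\Bbbk$-vector space $V$, not necessarily finite-dimensional, with a linear action of $G$ that comes from a $\Bbbk[G]$-comodule structure, that is, for every $v\in V$ there are finitely many $v_i\in V$ and $f_i\in\Bbbk[G]$ with $x\cdot v=\sum_i f_i(x)\,v_i$ for all $x\in G$; rational $H$-modules are defined in the same way with $\Bbbk[H]$. The subgroup $H$ is called observable in $G$ if for every finite-dimensional rational $H$-module $M$ there are a rational $G$-module $N$ and an injective $H$-equivariant linear map $M\to N$. The homogeneous space $G/H$ is the set of left cosets $xH$ with the quotient topology of the Zariski topology of $G$ under the projection $\pi\colon G\to G/H$ and with the structure sheaf whose sections on an open set $U\subseteq G/H$ are the functions $f\colon U\to\Bbbk$ such that $f\circ\pi$ is regular on $\pi^{-1}(U)$. It is called quasi-affine if it is isomorphic, as a space with a sheaf of $\Bbbk$-valued functions, to an open subset of an affine variety.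 Then $H$ is observable in $G$ if and only if the homogeneous space $G/H$ is quasi-affine. -/

import Mathlib

open TopologicalSpace

universe u v w

noncomputable section

/-! ### Affine varieties, given by a point set and its algebra of polynomial functions -/

/-- The pair `(X, A)` is an affine variety over `k` with algebra of polynomial functions `A`:
`A` is a finitely generated algebra of `k`-valued functions on `X`, it separates the points of `X`,
and every `k`-algebra homomorphism `A → k` is the evaluation at a point of `X`. -/
structure IsAffineVariety {k : Type u} [Field k] {X : Type v} (A : Subalgebra k (X → k)) :
    Prop where
  fg : A.FG
  eval_bijective :
    Function.Bijective fun x : X => ((Pi.evalAlgHom k (fun _ : X => k) x).comp A.val : A →ₐ[k] k)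

/-- The Zariski topology on `X`: the sets `{x | f x ≠ 0}`, `f ∈ A`, are a basis of it. -/
@[reducible]
def zariskiTopology {k : Type u} [Field k] {X : Type v} (A : Subalgebra k (X → k)) :
    TopologicalSpace X :=
  generateFrom {U | ∃ f ∈ A, U = {x | f x ≠ 0}}

/-- A group `G` with an algebra `A` of `k`-valued functions is an affine algebraic group: `(G, A)` is
an affine variety, and the multiplication and the inversion are morphisms of varieties, that is,
for `f ∈ A` the function `(x, y) ↦ f (x * y)` lies in `A ⊗ A` and `x ↦ f x⁻¹` lies in `A`. -/
structure IsAffineAlgebraicGroup {k : Type u} [Field k] {G : Type v} [Group G]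
    (A : Subalgebra k (G → k)) : Prop extends IsAffineVariety A where
  mul_mem' : ∀ f ∈ A, ∃ (n : ℕ) (f₁ f₂ : Fin n → G → k), (∀ i, f₁ i ∈ A) ∧ (∀ i, f₂ i ∈ A) ∧
    ∀ x y : G, f (x * y) = ∑ i, f₁ i x * f₂ i y
  inv_mem' : ∀ f ∈ A, (fun x => f x⁻¹) ∈ A

/-- The restrictions to `S` of the functions in `A`; this is the algebra of polynomial functions
of `S` if `S` is closed. -/
def restrictFunctions {k : Type u} [Field k] {X : Type v} (A : Subalgebra k (X → k)) (S : Set X) :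
    Subalgebra k (S → k) :=
  A.map (AlgHom.pi fun s => Pi.evalAlgHom k (fun _ : X => k) s.1)

/-! ### Rational modules and observable subgroups -/

/-- A linear representation of `G` on `V` (of any dimension) is rational if it comes from an
`A`-comodule structure `V → V ⊗ A`: for every `v` there are finitely many `vᵢ ∈ V`, `fᵢ ∈ A` with
`x • v = ∑ fᵢ(x) vᵢ` for all `x ∈ G`. -/
def IsRationalRepresentation {k : Type u} [Field k] {G : Type v} [Group G]
    (A : Subalgebra k (G → k)) {V : Type w} [AddCommGroup V] [Module k V]
    (ρ : Representation k G V) : Prop :=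
  ∀ v : V, ∃ (n : ℕ) (f : Fin n → G → k) (b : Fin n → V), (∀ i, f i ∈ A) ∧
    ∀ x : G, ρ x v = ∑ i, f i x • b i

/-- `H` is observable in `G`: every finite-dimensional rational `H`-module is isomorphic to an
`H`-submodule of a rational `G`-module. (Finite-dimensional spaces, and the `G`-submodules of
rational modules that they generate, have copies in the universe of `k`.) -/
def IsObservable {k : Type u} [Field k] {G : Type v} [Group G]
    (A : Subalgebra k (G → k)) (H : Subgroup G) : Prop :=
  ∀ (M : Type u) [AddCommGroup M] [Module k M] [FiniteDimensional k M]
    (σ : Representation k H M),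
    IsRationalRepresentation (restrictFunctions A (H : Set G)) σ →
    ∃ (N : Type u) (_ : AddCommGroup N) (_ : Module k N) (ρ : Representation k G N),
      IsRationalRepresentation A ρ ∧
      ∃ ι : M →ₗ[k] N, Function.Injective ι ∧ ∀ (h : H) (m : M), ι (σ h m) = ρ (h : G) (ι m)

/-! ### Spaces with functions -/

/-- A topological space with a sheaf of `k`-algebras of `k`-valued functions (the regular
functions). -/
structure SpaceWithFunctions (k : Type u) [Field k] where
  carrier : Type v
  [top : TopologicalSpace carrier]
  /-- The algebra of regular functions on an open set. -/
  regular (U : Opens carrier) : Subalgebra k (U → k)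
  restrict : ∀ {U V : Opens carrier} (h : V ≤ U) (f : U → k), f ∈ regular U →
    (fun y : V => f ⟨y.1, h y.2⟩) ∈ regular V
  glue : ∀ {U : Opens carrier} (f : U → k),
    (∀ x : U, ∃ (V : Opens carrier) (h : V ≤ U), x.1 ∈ V ∧
      (fun y : V => f ⟨y.1, h y.2⟩) ∈ regular V) → f ∈ regular U

attribute [instance] SpaceWithFunctions.top

namespace SpaceWithFunctions

/-- `φ` is an isomorphism of `X` onto an open subset of `Y`: it is a homeomorphism onto an open
subset, and for every open `V` inside the image of `φ` a function `f` on `V` is regular if and only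
if `f ∘ φ` is regular on the preimage of `V`. -/
def IsOpenImmersion {k : Type u} [Field k] (X : SpaceWithFunctions.{u, v} k)
    (Y : SpaceWithFunctions.{u, w} k) (φ : C(X.carrier, Y.carrier)) : Prop :=
  Topology.IsOpenEmbedding φ ∧
    ∀ V : Opens Y.carrier, (V : Set Y.carrier) ⊆ Set.range φ → ∀ f : V → k,
      f ∈ Y.regular V ↔
        (fun x : Opens.comap φ V => f ⟨φ x.1, x.2⟩) ∈ X.regular (Opens.comap φ V)

/-- An affine variety as a space with functions: it has the Zariski topology, and a function on an
open set is regular if locally it is a quotient `g / h` with `g, h ∈ A` and `h` without zeros. -/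
def ofAffine {k : Type u} [Field k] {X : Type v} (A : Subalgebra k (X → k)) :
    SpaceWithFunctions.{u, v} k :=
  letI : TopologicalSpace X := zariskiTopology A
  { carrier := X
    regular := fun U =>
      { carrier := {f | ∀ x : U, ∃ V : Opens X, x.1 ∈ V ∧ ∃ g ∈ A, ∃ h ∈ A,
          ∀ y : U, y.1 ∈ V → h y.1 ≠ 0 ∧ f y = g y.1 / h y.1}
        mul_mem' := by
          intro a b ha hb x
          obtain ⟨V, hxV, g, hg, h, hh, H⟩ := ha x
          obtain ⟨V', hxV', g', hg', h', hh', H'⟩ := hb x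
          refine ⟨V ⊓ V', ⟨hxV, hxV'⟩, g * g', A.mul_mem hg hg', h * h', A.mul_mem hh hh',
            fun y hy => ?_⟩
          obtain ⟨h1, h2⟩ := H y hy.1
          obtain ⟨h1', h2'⟩ := H' y hy.2
          exact ⟨mul_ne_zero h1 h1', by simp [h2, h2', div_mul_div_comm]⟩
        add_mem' := by
          intro a b ha hb x
          obtain ⟨V, hxV, g, hg, h, hh, H⟩ := ha x
          obtain ⟨V', hxV', g', hg', h', hh', H'⟩ := hb x
          refine ⟨V ⊓ V', ⟨hxV, hxV'⟩, g * h' + h * g',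
            A.add_mem (A.mul_mem hg hh') (A.mul_mem hh hg'), h * h', A.mul_mem hh hh',
            fun y hy => ?_⟩
          obtain ⟨h1, h2⟩ := H y hy.1
          obtain ⟨h1', h2'⟩ := H' y hy.2
          exact ⟨mul_ne_zero h1 h1', by simp [h2, h2', div_add_div _ _ h1 h1']⟩
        algebraMap_mem' := by
          intro r x
          exact ⟨⊤, trivial, algebraMap k (X → k) r, A.algebraMap_mem r, 1, A.one_mem,
            fun y _ => ⟨one_ne_zero, by simp⟩⟩ }
    restrict := by
      intro U V hVU f hf x
      obtain ⟨W, hxW, g, hg, h, hh, H⟩ := hf ⟨x.1, hVU x.2⟩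
      exact ⟨W, hxW, g, hg, h, hh, fun y hy => H ⟨y.1, hVU y.2⟩ hy⟩
    glue := by
      intro U f hf x
      obtain ⟨V, hVU, hxV, hfV⟩ := hf x
      obtain ⟨W, hxW, g, hg, h, hh, H⟩ := hfV ⟨x.1, hxV⟩
      exact ⟨V ⊓ W, ⟨hxV, hxW⟩, g, hg, h, hh, fun y hy => H ⟨y.1, hy.1⟩ hy.2⟩ }

/-- The quotient of a space with functions `X` by an equivalence relation: it has the quotient
topology, and a function on an open set `U` is regular if its pullback to the preimage of `U` in
`X` is regular. -/
def quotient {k : Type u} [Field k] (X : SpaceWithFunctions.{u, v} k) (r : Setoid X.carrier) :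
    SpaceWithFunctions.{u, v} k where
  carrier := Quotient r
  regular U := (X.regular (Opens.comap ⟨Quotient.mk r, continuous_quotient_mk'⟩ U)).comap
    (AlgHom.pi fun x => Pi.evalAlgHom k (fun _ : U => k) ⟨Quotient.mk r x.1, x.2⟩)
  restrict := by
    intro U V h f hf
    exact X.restrict (Opens.comap_mono _ h) _ hf
  glue := by
    intro U f hf
    refine X.glue _ fun x => ?_
    obtain ⟨V, hVU, hxV, hfV⟩ := hf ⟨Quotient.mk r x.1, x.2⟩
    exact ⟨Opens.comap _ V, Opens.comap_mono _ hVU, hxV, hfV⟩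

/-- A quasi-affine variety is a space with functions that is isomorphic to an open subset of an
affine variety. (Every affine variety over `k` has a copy in the universe of `k`.) -/
def IsQuasiAffine {k : Type u} [Field k] (X : SpaceWithFunctions.{u, v} k) : Prop :=
  ∃ (Y : Type u) (B : Subalgebra k (Y → k)), IsAffineVariety B ∧
    ∃ φ : C(X.carrier, (ofAffine B).carrier), IsOpenImmersion X (ofAffine B) φ

end SpaceWithFunctions

/-- The homogeneous space `G/H` of left cosets `xH`: the quotient of the variety `G` by the right
multiplications by elements of `H`. -/
def homogeneousSpace {k : Type u} [Field k] {G : Type v} [Group G]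
    (A : Subalgebra k (G → k)) (H : Subgroup G) : SpaceWithFunctions.{u, v} k :=
  (SpaceWithFunctions.ofAffine A).quotient (@QuotientGroup.leftRel G _ H)

end

/-!
If `H` is observable, then every finite-dimensional `H`-module `M` gives a polynomial map
`a : G → End M` with `a 1 = 1` and `a (x * h) = a x * σ h`, where `σ` is the action of `H`. For
duals of finite-dimensional spaces of functions, these maps turn a function in an `H`-stable ideal
`J` of `k[G]` into an `H`-invariant function in `J` with the same value at `1`. So there are enough
invariant functions to give a basis of the topology of `G/H`, and finitely many of them generate the
ideal of `H` near `1`. Let `B` be a finitely generated algebra of invariant functions that is stable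
under left translations and contains these generators. A point of `G` with values in any `k`-algebra
that is trivial on `B` lies in `H`, hence `f ⊗ 1 = 1 ⊗ f` in `k[G] ⊗_B k[G]` for every invariant
`f`. Over the local ring of `B` at a minimal prime, which is a field, this descends `f` to a
fraction of elements of `B`, and translating by `G` makes this valid near every point; in the same
way the image of `G/H` in the affine variety with coordinate ring `B` is open, by Chevalley's
theorem and translations. Hence `G/H` is an open subset of this variety.

Conversely, if `G/H` is quasi-affine, then the sets `{f ≠ 0}` with `f` invariant are a basis of its
topology. An `H`-module `M` embeds into a quotient `V / W` of a `G`-module `V` by an `H`-submodule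
`W`. The Schur complement of the block of `W` in the matrix of `x` on `V` vanishes on `W`, and it is
`H`-equivariant up to the determinant of that block, which is a semi-invariant of `H`. An invariant
function that is nonzero only where this determinant is nonzero provides a function with the inverse
character, and multiplying by it yields a map `a` as above, which embeds `M` into the `G`-module of
polynomial maps from `G` to `M`.
-/

open scoped Topology

section AffineVariety

variable {k : Type u} [Field k]

theorem exists_algHom_ker_eq [IsAlgClosed k] {R : Type*} [CommRing R] [Algebra k R]
    [Algebra.FiniteType k R] (m : Ideal R) [m.IsMaximal] :
    ∃ ψ : R →ₐ[k] k, RingHom.ker ψ = m := by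
  let : Field (R ⧸ m) := Ideal.Quotient.field m
  have : Module.Finite k (R ⧸ m) := finite_of_finite_type_of_isJacobsonRing k (R ⧸ m)
  let e : k ≃ₐ[k] R ⧸ m := AlgEquiv.ofBijective (Algebra.ofId k (R ⧸ m))
    IsAlgClosed.algebraMap_bijective_of_isIntegral
  refine ⟨e.symm.toAlgHom.comp (Ideal.Quotient.mkₐ k m), Ideal.ext fun r => ?_⟩
  rw [RingHom.mem_ker, ← Ideal.Quotient.eq_zero_iff_mem]
  simp

variable {X : Type v} {A : Subalgebra k (X → k)}

theorem IsAffineVariety.exists_forall_mem_iff [IsAlgClosed k] (hA : IsAffineVariety A)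
    (m : Ideal A) [m.IsMaximal] : ∃ x : X, ∀ f : A, f ∈ m ↔ f.1 x = 0 := by
  have : Algebra.FiniteType k A := A.fg_iff_finiteType.mp hA.fg
  obtain ⟨ψ, rfl⟩ := exists_algHom_ker_eq (k := k) m
  obtain ⟨x, rfl⟩ := hA.eval_bijective.2 ψ
  exact ⟨x, fun f => Iff.rfl⟩

theorem IsAffineVariety.mem_radical [IsAlgClosed k] (hA : IsAffineVariety A) {J : Ideal A}
    {b : A} (hb : ∀ x, (∀ f ∈ J, f.1 x = 0) → b.1 x = 0) : b ∈ J.radical := by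
  have : Algebra.FiniteType k A := A.fg_iff_finiteType.mp hA.fg
  have : IsJacobsonRing A := isJacobsonRing_of_finiteType (A := k)
  rw [Ideal.radical_eq_jacobson, Ideal.jacobson, Ideal.mem_sInf]
  rintro m ⟨hJm, hm⟩
  obtain ⟨x, hx⟩ := hA.exists_forall_mem_iff m
  exact (hx b).2 (hb x fun f hf => (hx f).1 (hJm hf))

theorem isTopologicalBasis_zariskiTopology (A : Subalgebra k (X → k)) :
    @IsTopologicalBasis X (zariskiTopology A) {U | ∃ f ∈ A, U = {x | f x ≠ 0}} := by
  let := zariskiTopology A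
  refine ⟨?_, Set.sUnion_eq_univ_iff.2 fun x => ?_, rfl⟩
  · rintro _ ⟨f, hf, rfl⟩ _ ⟨g, hg, rfl⟩ x hx
    refine ⟨_, ⟨f * g, A.mul_mem hf hg, rfl⟩, mul_ne_zero hx.1 hx.2, fun y hy => ?_⟩
    exact ⟨left_ne_zero_of_mul hy, right_ne_zero_of_mul hy⟩
  · exact ⟨_, ⟨1, A.one_mem, rfl⟩, one_ne_zero⟩

theorem isOpen_zariskiTopology_iff {U : Set X} :
    IsOpen[zariskiTopology A] U ↔
      ∀ x ∈ U, ∃ f ∈ A, f x ≠ 0 ∧ ∀ y, f y ≠ 0 → y ∈ U := by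
  let := zariskiTopology A
  rw [(isTopologicalBasis_zariskiTopology A).isOpen_iff]
  refine forall₂_congr fun x _ => ⟨?_, ?_⟩
  · rintro ⟨_, ⟨f, hf, rfl⟩, hx, hU⟩
    exact ⟨f, hf, hx, hU⟩
  · rintro ⟨f, hf, hx, hU⟩
    exact ⟨_, ⟨f, hf, rfl⟩, hx, hU⟩

theorem isOpen_zariskiTopology_ne_zero {f : X → k} (hf : f ∈ A) :
    IsOpen[zariskiTopology A] {x | f x ≠ 0} :=
  isOpen_generateFrom_of_mem ⟨f, hf, rfl⟩

variable (A) in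
/-- The function `f` on `U ⊆ X` is regular: locally it is a quotient `g / d` of polynomial
functions. The division is cleared, which makes the equation hold on all of `U`. -/
def IsRegularOn (U : Set X) (f : U → k) : Prop :=
  ∀ x : U, ∃ g ∈ A, ∃ d ∈ A, d x ≠ 0 ∧ ∀ y : U, d y * f y = g y

theorem mem_regular_ofAffine_iff {U : Opens (SpaceWithFunctions.ofAffine A).carrier} {f : U → k} :
    f ∈ (SpaceWithFunctions.ofAffine A).regular U ↔ IsRegularOn A U.1 f := by
  let := zariskiTopology A
  refine forall_congr' fun (x : U.1) => ⟨?_, ?_⟩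
  · rintro ⟨V, hxV, g, hg, d, hd, h⟩
    obtain ⟨s, hs, hsx, hsV⟩ := isOpen_zariskiTopology_iff.1 V.2 x.1 hxV
    refine ⟨s * g, A.mul_mem hs hg, s * d, A.mul_mem hs hd, mul_ne_zero hsx (h x hxV).1,
      fun y => ?_⟩
    rcases eq_or_ne (s y) 0 with hsy | hsy
    · simp [hsy]
    · obtain ⟨hdy, hfy⟩ := h y (hsV _ hsy)
      rw [hfy, Pi.mul_apply, Pi.mul_apply, mul_assoc, mul_div_cancel₀ _ hdy]
  · rintro ⟨g, hg, d, hd, hdx, h⟩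
    exact ⟨⟨{y | d y ≠ 0}, isOpen_zariskiTopology_ne_zero hd⟩, hdx, g, hg, d, hd,
      fun y hy => ⟨hy, eq_div_of_mul_eq hy ((mul_comm _ _).trans (h y))⟩⟩

theorem IsAffineVariety.exists_pow_mul_eq [IsAlgClosed k] (hA : IsAffineVariety A) {U : Set X}
    {f : U → k} (hf : IsRegularOn A U f) {c : A} (hcU : ∀ x, c.1 x ≠ 0 → x ∈ U) :
    ∃ (n : ℕ) (g : A), ∀ y : U, c.1 y ^ n * f y = g.1 y := by
  let J : Ideal A :=
    { carrier := {d | ∃ g : A, ∀ y : U, d.1 y * f y = g.1 y}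
      zero_mem' := ⟨0, fun y => zero_mul _⟩
      add_mem' := by
        rintro a b ⟨g, h⟩ ⟨g', h'⟩
        exact ⟨g + g', fun y => by simp [add_mul, h, h']⟩
      smul_mem' := by
        rintro a b ⟨g, h⟩
        exact ⟨a * g, fun y => by simp [mul_assoc, h]⟩ }
  have hcJ : c ∈ J.radical := hA.mem_radical fun x hx => by
    by_contra hcx
    obtain ⟨g, hg, d, hd, hdx, h⟩ := hf ⟨x, hcU x hcx⟩
    exact hdx (hx ⟨d, hd⟩ ⟨⟨g, hg⟩, h⟩)
  exact hcJ

end AffineVariety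

section PolynomialMaps

variable {k : Type u} [Field k] {X Y : Type*} {A : Subalgebra k (X → k)}
  {V W U : Type*} [AddCommGroup V] [Module k V] [AddCommGroup W] [Module k W]
  [AddCommGroup U] [Module k U]

variable (A V) in
/-- The polynomial maps from `(X, A)` to a vector space `V`, that is, the image of `A ⊗ V` in the
space of all maps `X → V`. -/
def polynomialMaps : Submodule k (X → V) :=
  Submodule.span k {F | ∃ f ∈ A, ∃ v, F = fun x => f x • v}

namespace polynomialMaps

theorem smul_mem {f : X → k} (hf : f ∈ A) (v : V) : (fun x => f x • v) ∈ polynomialMaps A V :=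
  Submodule.subset_span ⟨f, hf, v, rfl⟩

theorem mem_iff {F : X → V} :
    F ∈ polynomialMaps A V ↔ ∃ (n : ℕ) (f : Fin n → X → k) (b : Fin n → V), (∀ i, f i ∈ A) ∧
      ∀ x, F x = ∑ i, f i x • b i := by
  constructor
  · intro hF
    obtain ⟨n, c, g, rfl⟩ := Submodule.mem_span_set'.1 hF
    choose f hf b hb using fun i => (g i).2
    exact ⟨n, fun i => c i • f i, b, fun i => A.smul_mem (hf i) _,
      fun x => by simp [hb, mul_smul]⟩
  · rintro ⟨n, f, b, hf, h⟩
    have : F = ∑ i, fun x => f i x • b i := by ext x; simp [h]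
    exact this ▸ Submodule.sum_mem _ fun i _ => smul_mem (hf i) _

theorem exists_restrict_eq {S : Set X} {F : S → V}
    (hF : F ∈ polynomialMaps (restrictFunctions A S) V) :
    ∃ F' ∈ polynomialMaps A V, ∀ s : S, F' s = F s := by
  obtain ⟨n, f, b, hf, h⟩ := mem_iff.1 hF
  choose f' hf' hff' using hf
  exact ⟨_, mem_iff.2 ⟨n, f', b, hf', fun _ => rfl⟩, fun s => by simp [h, ← hff']⟩

theorem mem_self_iff {F : X → k} : F ∈ polynomialMaps A k ↔ F ∈ A := by
  refine ⟨fun hF => ?_, fun hF => by simpa using smul_mem hF (1 : k)⟩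
  refine Submodule.span_le (p := Subalgebra.toSubmodule A).2 ?_ hF
  rintro _ ⟨f, hf, c, rfl⟩
  exact A.mul_mem hf (A.algebraMap_mem c)

theorem map_mem {F : X → V} (hF : F ∈ polynomialMaps A V) (L : V →ₗ[k] W) :
    (fun x => L (F x)) ∈ polynomialMaps A W := by
  obtain ⟨n, f, b, hf, h⟩ := mem_iff.1 hF
  exact mem_iff.2 ⟨n, f, L ∘ b, hf, fun x => by simp [h]⟩

theorem map₂_mem {F : X → V} (hF : F ∈ polynomialMaps A V) {F' : X → W}
    (hF' : F' ∈ polynomialMaps A W) (L : V →ₗ[k] W →ₗ[k] U) :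
    (fun x => L (F x) (F' x)) ∈ polynomialMaps A U := by
  obtain ⟨n, f, b, hf, h⟩ := mem_iff.1 hF
  obtain ⟨n', f', b', hf', h'⟩ := mem_iff.1 hF'
  have : (fun x => L (F x) (F' x)) =
      ∑ i, ∑ j, fun x => (f i * f' j) x • L (b i) (b' j) := by
    ext x
    simp only [h, h', map_sum, map_smul, LinearMap.sum_apply, LinearMap.smul_apply, Pi.mul_apply,
      Finset.sum_apply, mul_smul, Finset.smul_sum]
    rw [Finset.sum_comm]
    exact Finset.sum_congr rfl fun i _ => Finset.sum_congr rfl fun j _ => smul_comm _ _ _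
  rw [this]
  exact Submodule.sum_mem _ fun i _ => Submodule.sum_mem _ fun j _ =>
    smul_mem (A.mul_mem (hf i) (hf' j)) _

theorem comp_mem {B : Subalgebra k (Y → k)} {φ : X → Y} (hφ : ∀ f ∈ B, (fun x => f (φ x)) ∈ A)
    {F : Y → V} (hF : F ∈ polynomialMaps B V) : (fun x => F (φ x)) ∈ polynomialMaps A V := by
  obtain ⟨n, f, b, hf, h⟩ := mem_iff.1 hF
  exact mem_iff.2 ⟨n, _, b, fun i => hφ _ (hf i), fun x => h (φ x)⟩

theorem codRestrict_mem {P : Submodule k V} {F : X → P}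
    (hF : (fun x => (F x : V)) ∈ polynomialMaps A V) : F ∈ polynomialMaps A P := by
  obtain ⟨π, hπ⟩ := P.subtype.exists_leftInverse_of_injective P.ker_subtype
  have : F = fun x => π (F x) := funext fun x => (LinearMap.congr_fun hπ (F x)).symm
  exact this ▸ map_mem hF π

theorem pi_mem {ι : Type*} [Finite ι] {F : X → ι → V}
    (hF : ∀ i, (fun x => F x i) ∈ polynomialMaps A V) : F ∈ polynomialMaps A (ι → V) := by
  classical
  cases nonempty_fintype ι
  have : F = ∑ i, fun x => LinearMap.single k (fun _ => V) i (F x i) := by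
    ext x j; simp [Pi.single_apply]
  exact this ▸ Submodule.sum_mem _ fun i _ => map_mem (hF i) _

theorem linearMap_mem [FiniteDimensional k V] {F : X → V →ₗ[k] W}
    (hF : ∀ v, (fun x => F x v) ∈ polynomialMaps A W) : F ∈ polynomialMaps A (V →ₗ[k] W) := by
  let b := Module.finBasis k V
  have : F = fun x => b.constr k fun i => F x (b i) := funext fun x => (b.constr_self k (F x)).symm
  rw [this]
  exact map_mem (pi_mem fun i => hF (b i)) (b.constr k).toLinearMap

theorem finiteDimensional_span_range {F : X → V} (hF : F ∈ polynomialMaps A V) :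
    FiniteDimensional k (Submodule.span k (Set.range F)) := by
  obtain ⟨n, f, b, -, h⟩ := mem_iff.1 hF
  have := FiniteDimensional.span_of_finite k (Set.finite_range b)
  refine Submodule.finiteDimensional_of_le (S₂ := Submodule.span k (Set.range b))
    (Submodule.span_le.2 ?_)
  rintro _ ⟨x, rfl⟩
  exact h x ▸ Submodule.sum_smul_mem _ _ fun i _ => Submodule.subset_span ⟨i, rfl⟩

end polynomialMaps

end PolynomialMaps

theorem comp_val_mem_restrictFunctions {k : Type u} [Field k] {X : Type v}
    {A : Subalgebra k (X → k)} {S : Set X} {f : X → k} (hf : f ∈ A) :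
    (fun s : S => f s) ∈ restrictFunctions A S :=
  ⟨f, hf, rfl⟩

section RationalRepresentation

variable {k : Type u} [Field k] {G : Type v} [Group G] {A : Subalgebra k (G → k)}
  {V : Type*} [AddCommGroup V] [Module k V] {ρ : Representation k G V}

theorem isRationalRepresentation_iff :
    IsRationalRepresentation A ρ ↔ ∀ v, (fun x => ρ x v) ∈ polynomialMaps A V :=
  forall_congr' fun _ => polynomialMaps.mem_iff.symm

namespace IsRationalRepresentation

theorem orbitMap_mem (hρ : IsRationalRepresentation A ρ) (v : V) :
    (fun x => ρ x v) ∈ polynomialMaps A V :=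
  isRationalRepresentation_iff.1 hρ v

theorem mem_polynomialMaps [FiniteDimensional k V] (hρ : IsRationalRepresentation A ρ) :
    (fun x => ρ x) ∈ polynomialMaps A (Module.End k V) :=
  polynomialMaps.linearMap_mem hρ.orbitMap_mem

theorem subrepresentation (hρ : IsRationalRepresentation A ρ) {P : Submodule k V}
    (hP : ∀ x, P ≤ P.comap (ρ x)) : IsRationalRepresentation A (ρ.subrepresentation P hP) :=
  isRationalRepresentation_iff.2 fun v =>
    polynomialMaps.codRestrict_mem (hρ.orbitMap_mem (v : V))

theorem conj {W : Type*} [AddCommGroup W] [Module k W] (hρ : IsRationalRepresentation A ρ)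
    (e : V ≃ₗ[k] W) :
    IsRationalRepresentation A ((e.conjAlgEquiv k : _ →* Module.End k W).comp ρ) :=
  isRationalRepresentation_iff.2 fun w =>
    polynomialMaps.map_mem (hρ.orbitMap_mem (e.symm w)) e.toLinearMap

theorem comp_subtype (hρ : IsRationalRepresentation A ρ) (H : Subgroup G) :
    IsRationalRepresentation (restrictFunctions A (H : Set G)) (ρ.comp H.subtype) :=
  isRationalRepresentation_iff.2 fun v => polynomialMaps.comp_mem
    (fun _ => comp_val_mem_restrictFunctions) (hρ.orbitMap_mem v)

theorem dual [FiniteDimensional k V] (hinv : ∀ f ∈ A, (fun x => f x⁻¹) ∈ A)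
    (hρ : IsRationalRepresentation A ρ) : IsRationalRepresentation A ρ.dual :=
  isRationalRepresentation_iff.2 fun ℓ =>
    polynomialMaps.map_mem (polynomialMaps.comp_mem hinv hρ.mem_polynomialMaps)
      (LinearMap.llcomp k V V k ℓ)

theorem exists_stable_finiteDimensional (hρ : IsRationalRepresentation A ρ) {S : Set V}
    (hS : S.Finite) : ∃ P : Submodule k V, FiniteDimensional k P ∧ (∀ x, P ≤ P.comap (ρ x)) ∧
      S ⊆ P ∧ ∀ Q : Submodule k V, S ⊆ Q → (∀ x, Q ≤ Q.comap (ρ x)) → P ≤ Q := by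
  refine ⟨Submodule.span k (⋃ v ∈ S, Set.range fun x => ρ x v), ?_, fun x => ?_, fun v hv => ?_,
    fun Q hSQ hQ => ?_⟩
  · have := hS.to_subtype
    have := fun v : S => polynomialMaps.finiteDimensional_span_range (hρ.orbitMap_mem v.1)
    rw [Set.biUnion_eq_iUnion, Submodule.span_iUnion]
    infer_instance
  · rw [Submodule.span_le]
    rintro _ hw
    obtain ⟨v, hv, y, rfl⟩ := Set.mem_iUnion₂.1 hw
    refine Submodule.subset_span (Set.mem_biUnion hv ⟨x * y, ?_⟩)
    simp
  · exact Submodule.subset_span (Set.mem_biUnion hv ⟨1, by simp⟩)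
  · exact Submodule.span_le.2 <| Set.iUnion₂_subset fun v hv => by
      rintro _ ⟨x, rfl⟩
      exact hQ x (hSQ hv)

theorem exists_stable_finiteDimensional_forall_mem (hρ : IsRationalRepresentation A ρ)
    {M : Type*} [AddCommGroup M] [Module k M] [FiniteDimensional k M] (j : M →ₗ[k] V) :
    ∃ P : Submodule k V, FiniteDimensional k P ∧ (∀ x, P ≤ P.comap (ρ x)) ∧ ∀ m, j m ∈ P := by
  let b := Module.finBasis k M
  obtain ⟨P, hPfin, hP, hjP, -⟩ := hρ.exists_stable_finiteDimensional (Set.finite_range (j ∘ b))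
  refine ⟨P, hPfin, hP, fun m => Submodule.span_le (p := P.comap j).2 ?_ (b.mem_span m)⟩
  rintro _ ⟨i, rfl⟩
  exact hjP ⟨i, rfl⟩

end IsRationalRepresentation

end RationalRepresentation

section Translation

variable {k : Type u} [Field k]

section Pullback

variable {X Y : Type*} {A : Subalgebra k (X → k)} {B : Subalgebra k (Y → k)}

/-- The homomorphism of coordinate rings given by composition with a morphism `φ : X → Y`. -/
def pullback (φ : X → Y) (hφ : ∀ f ∈ B, (fun x => f (φ x)) ∈ A) : B →ₐ[k] A :=
  ((AlgHom.pi fun x => Pi.evalAlgHom k (fun _ : Y => k) (φ x)).comp B.val).codRestrict A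
    fun f => hφ f.1 f.2

@[simp]
theorem pullback_apply {φ : X → Y} (hφ : ∀ f ∈ B, (fun x => f (φ x)) ∈ A) (f : B) (x : X) :
    (pullback φ hφ f).1 x = f.1 (φ x) :=
  rfl

end Pullback

namespace IsAffineAlgebraicGroup

variable {G : Type v} [Group G] {A : Subalgebra k (G → k)} (hA : IsAffineAlgebraicGroup A)

include hA

theorem exists_coproduct (f : A) : ∃ (n : ℕ) (p q : Fin n → A),
    ∀ x y, f.1 (x * y) = ∑ i, (p i).1 x * (q i).1 y := by
  obtain ⟨n, p, q, hp, hq, h⟩ := hA.mul_mem' f.1 f.2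
  exact ⟨n, fun i => ⟨p i, hp i⟩, fun i => ⟨q i, hq i⟩, h⟩

theorem mul_right_mem (g : G) : ∀ f ∈ A, (fun x => f (x * g)) ∈ A := by
  intro f hf
  obtain ⟨n, p, q, h⟩ := hA.exists_coproduct ⟨f, hf⟩
  have : (fun x => f (x * g)) = (∑ i, (q i).1 g • p i : A).1 := by
    ext x; simpa [mul_comm] using h x g
  exact this ▸ Subtype.prop _

theorem mul_left_mem (g : G) : ∀ f ∈ A, (fun x => f (g * x)) ∈ A := by
  intro f hf
  obtain ⟨n, p, q, h⟩ := hA.exists_coproduct ⟨f, hf⟩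
  have : (fun x => f (g * x)) = (∑ i, (p i).1 g • q i : A).1 := by
    ext x; simpa using h g x
  exact this ▸ Subtype.prop _

/-- Translation of polynomial functions: `(rightTranslate g f) x = f (x * g)`. -/
abbrev rightTranslate (g : G) : A →ₐ[k] A := pullback (fun x => x * g) (hA.mul_right_mem g)

/-- Translation of polynomial functions: `(leftTranslate g f) x = f (g * x)`. -/
abbrev leftTranslate (g : G) : A →ₐ[k] A := pullback (fun x => g * x) (hA.mul_left_mem g)

/-- The action of `G` on `k[G]` given by `(g • f) x = f (x * g)`. -/
def rightRegular : Representation k G A where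
  toFun g := (hA.rightTranslate g).toLinearMap
  map_one' := by ext f x; simp
  map_mul' g g' := by ext f x; simp [mul_assoc]

/-- The action of `G` on `k[G]` given by `(g • f) x = f (g⁻¹ * x)`. -/
def leftRegular : Representation k G A where
  toFun g := (hA.leftTranslate g⁻¹).toLinearMap
  map_one' := by ext f x; simp
  map_mul' g g' := by ext f x; simp [mul_assoc]

theorem rightTranslate_mem_polynomialMaps (f : A) :
    (fun g => hA.rightTranslate g f) ∈ polynomialMaps A A := by
  obtain ⟨n, p, q, h⟩ := hA.exists_coproduct f
  exact polynomialMaps.mem_iff.2 ⟨n, fun i => (q i).1, p, fun i => (q i).2, fun g => by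
    ext x; simp [h, mul_comm]⟩

theorem leftTranslate_mem_polynomialMaps (f : A) :
    (fun g => hA.leftTranslate g f) ∈ polynomialMaps A A := by
  obtain ⟨n, p, q, h⟩ := hA.exists_coproduct f
  exact polynomialMaps.mem_iff.2 ⟨n, fun i => (p i).1, q, fun i => (p i).2, fun g => by
    ext x; simp [h]⟩

/-- The action of `G` on the polynomial maps to `V` given by `(g • F) x = F (x * g)`. -/
def polynomialMapsRegular (V : Type*) [AddCommGroup V] [Module k V] :
    Representation k G (polynomialMaps A V) where
  toFun g := (LinearMap.funLeft k V fun x => x * g).restrict fun _ hF =>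
    polynomialMaps.comp_mem (hA.mul_right_mem g) hF
  map_one' := by ext F x; simp [LinearMap.funLeft]
  map_mul' g g' := by ext F x; simp [LinearMap.funLeft, mul_assoc]

@[simp]
theorem polynomialMapsRegular_apply {V : Type*} [AddCommGroup V] [Module k V] (g : G)
    (F : polynomialMaps A V) (x : G) : (hA.polynomialMapsRegular V g F).1 x = F.1 (x * g) :=
  rfl

theorem isRationalRepresentation_polynomialMapsRegular (V : Type*) [AddCommGroup V] [Module k V] :
    IsRationalRepresentation A (hA.polynomialMapsRegular V) := by
  refine isRationalRepresentation_iff.2 fun F => ?_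
  obtain ⟨n, f, b, hf, h⟩ := polynomialMaps.mem_iff.1 F.2
  let L (i : Fin n) : A →ₗ[k] polynomialMaps A V :=
    { toFun := fun f => ⟨fun x => f.1 x • b i, polynomialMaps.smul_mem f.2 _⟩
      map_add' := fun _ _ => by ext; simp [add_smul]
      map_smul' := fun _ _ => by ext; simp [mul_smul] }
  have : (fun g => hA.polynomialMapsRegular V g F) =
      ∑ i, fun g => L i (hA.rightTranslate g ⟨f i, hf i⟩) := by
    ext g x
    simp [h, L]
  rw [this]
  exact Submodule.sum_mem _ fun i _ =>
    polynomialMaps.map_mem (hA.rightTranslate_mem_polynomialMaps _) (L i)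

theorem isRationalRepresentation_rightRegular : IsRationalRepresentation A hA.rightRegular :=
  isRationalRepresentation_iff.2 hA.rightTranslate_mem_polynomialMaps

theorem isRationalRepresentation_leftRegular : IsRationalRepresentation A hA.leftRegular :=
  isRationalRepresentation_iff.2 fun f =>
    polynomialMaps.comp_mem hA.inv_mem' (hA.leftTranslate_mem_polynomialMaps f)

theorem exists_coproduct_mem {P : Submodule k A} (hP : ∀ g, ∀ f ∈ P, hA.leftTranslate g f ∈ P)
    {f : A} (hf : f ∈ P) : ∃ (n : ℕ) (p q : Fin n → A), (∀ i, q i ∈ P) ∧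
      ∀ x y, f.1 (x * y) = ∑ i, (p i).1 x * (q i).1 y := by
  obtain ⟨n, p, q, hp, h⟩ := polynomialMaps.mem_iff.1 <| polynomialMaps.codRestrict_mem
    (F := fun g => (⟨hA.leftTranslate g f, hP g f hf⟩ : P)) (hA.leftTranslate_mem_polynomialMaps f)
  refine ⟨n, fun i => ⟨p i, hp i⟩, fun i => q i, fun i => (q i).2, fun x y => ?_⟩
  simpa using congrArg (fun F : P => F.1.1 y) (h x)

end IsAffineAlgebraicGroup

end Translation

section EquivariantExtension

variable {k : Type u} [Field k] {G : Type v} [Group G] {A : Subalgebra k (G → k)} {H : Subgroup G}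
  {M : Type w} [AddCommGroup M] [Module k M] {σ : Representation k H M}

variable (A) in
/-- The action map `H → End M` extends to an `H`-equivariant polynomial map on `G` (for
finite-dimensional `M`, this says that the evaluation at `1` maps the module induced from `M` to
`G` onto `M`). -/
def ExtendsEquivariantly (σ : Representation k H M) : Prop :=
  ∃ a ∈ polynomialMaps A (Module.End k M), a 1 = 1 ∧ ∀ (x : G) (h : H), a (x * h) = a x * σ h

theorem IsObservable.extendsEquivariantly [FiniteDimensional k M] (hobs : IsObservable A H)
    (hσ : IsRationalRepresentation (restrictFunctions A (H : Set G)) σ) :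
    ExtendsEquivariantly A σ := by
  let e := (Module.finBasis k M).equivFun
  obtain ⟨N, _, _, τ, hτ, ι, hι, hequiv⟩ := hobs _ _ (hσ.conj e)
  obtain ⟨r, hr⟩ := (ι ∘ₗ e.toLinearMap).exists_leftInverse_of_injective
    (LinearMap.ker_eq_bot.2 (hι.comp e.injective))
  refine ⟨fun x => r ∘ₗ τ x ∘ₗ ι ∘ₗ e.toLinearMap, ?_, ?_, fun x h => LinearMap.ext fun m => ?_⟩
  · exact polynomialMaps.linearMap_mem fun m => polynomialMaps.map_mem (hτ.orbitMap_mem _) r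
  · simpa [Module.End.one_eq_id] using hr
  · have : τ h (ι (e m)) = ι (e (σ h m)) := by simpa using (hequiv h (e m)).symm
    simp [this]

theorem ExtendsEquivariantly.exists_equivariant_embedding (hA : IsAffineAlgebraicGroup A)
    (hσ : ExtendsEquivariantly A σ) :
    ∃ ι : M →ₗ[k] polynomialMaps A M, Function.Injective ι ∧
      ∀ (h : H) (m : M), ι (σ h m) = hA.polynomialMapsRegular M h (ι m) := by
  obtain ⟨a, ha, ha1, hmul⟩ := hσ
  let ι : M →ₗ[k] polynomialMaps A M :=
    { toFun := fun m => ⟨fun x => a x m, polynomialMaps.map_mem ha (LinearMap.applyₗ m)⟩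
      map_add' := fun _ _ => by ext; simp
      map_smul' := fun _ _ => by ext; simp }
  refine ⟨ι, fun m m' hm => ?_, fun h m => ?_⟩
  · simpa [ι, ha1] using congrArg (fun F : polynomialMaps A M => F.1 1) hm
  · ext x
    simp [ι, hmul]

theorem IsRationalRepresentation.exists_embedding_in_base_universe {N : Type*} [AddCommGroup N]
    [Module k N] {τ : Representation k G N} (hτ : IsRationalRepresentation A τ)
    [FiniteDimensional k M] {ι : M →ₗ[k] N} (hι : Function.Injective ι)
    (hequiv : ∀ (h : H) (m : M), ι (σ h m) = τ h (ι m)) :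
    ∃ (N' : Type u) (_ : AddCommGroup N') (_ : Module k N') (ρ : Representation k G N'),
      IsRationalRepresentation A ρ ∧
      ∃ ι' : M →ₗ[k] N', Function.Injective ι' ∧ ∀ (h : H) (m : M), ι' (σ h m) = ρ h (ι' m) := by
  obtain ⟨P, _, hP, hrange⟩ := hτ.exists_stable_finiteDimensional_forall_mem ι
  let e := (Module.finBasis k P).equivFun
  refine ⟨_, _, _, _, (hτ.subrepresentation hP).conj e, e.toLinearMap ∘ₗ ι.codRestrict P hrange,
    e.injective.comp fun m m' h => hι (congrArg Subtype.val h), fun h m => ?_⟩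
  have : ι.codRestrict P hrange (σ h m) =
      τ.subrepresentation P hP h (ι.codRestrict P hrange m) := Subtype.ext (hequiv h m)
  simpa using this

theorem IsObservable.of_extendsEquivariantly (hA : IsAffineAlgebraicGroup A)
    (hext : ∀ (M : Type u) [AddCommGroup M] [Module k M] [FiniteDimensional k M]
      (σ : Representation k H M), IsRationalRepresentation (restrictFunctions A (H : Set G)) σ →
      ExtendsEquivariantly A σ) : IsObservable A H := by
  intro M _ _ _ σ hσ
  obtain ⟨ι, hι, hequiv⟩ := (hext M σ hσ).exists_equivariant_embedding hA
  exact (hA.isRationalRepresentation_polynomialMapsRegular M).exists_embedding_in_base_universe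
    hι hequiv

end EquivariantExtension

section HomogeneousSpace

variable {k : Type u} [Field k] {G : Type v} [Group G] {A : Subalgebra k (G → k)} {H : Subgroup G}

variable (A H) in
/-- The projection `G → G/H`, as a map to the points of the space with functions `G/H`. -/
def cosetMk (x : G) : (homogeneousSpace A H).carrier :=
  Quotient.mk (QuotientGroup.leftRel H) x

theorem cosetMk_surjective : Function.Surjective (cosetMk A H) :=
  Quotient.mk_surjective

theorem cosetMk_eq_iff {x y : G} : cosetMk A H x = cosetMk A H y ↔ x⁻¹ * y ∈ H :=
  Quotient.eq.trans QuotientGroup.leftRel_apply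

@[simp]
theorem cosetMk_mul (x : G) (h : H) : cosetMk A H (x * h) = cosetMk A H x :=
  cosetMk_eq_iff.2 (by simp)

theorem isOpen_homogeneousSpace_iff {U : Set (homogeneousSpace A H).carrier} :
    IsOpen U ↔ IsOpen[zariskiTopology A] (cosetMk A H ⁻¹' U) :=
  Iff.rfl

theorem mem_regular_homogeneousSpace_iff {U : Opens (homogeneousSpace A H).carrier} {f : U → k} :
    f ∈ (homogeneousSpace A H).regular U ↔
      IsRegularOn A (cosetMk A H ⁻¹' U) fun x => f ⟨cosetMk A H x, x.2⟩ :=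
  mem_regular_ofAffine_iff

variable (A H) in
/-- The polynomial functions on `G` that are constant on the cosets `xH`. -/
def invariantFunctions : Subalgebra k A where
  carrier := {f | ∀ (x : G) (h : H), f.1 (x * h) = f.1 x}
  mul_mem' hf hg x h := by simp [hf x h, hg x h]
  add_mem' hf hg x h := by simp [hf x h, hg x h]
  algebraMap_mem' _ _ _ := rfl

variable (A H) in
/-- The open sets `{f ≠ 0}`, for invariant polynomial functions `f`, are a basis of `G/H`. -/
def InvariantsSeparate : Prop :=
  ∀ U : Set (homogeneousSpace A H).carrier, IsOpen U → ∀ x, cosetMk A H x ∈ U →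
    ∃ f ∈ invariantFunctions A H, f.1 x ≠ 0 ∧ ∀ y, f.1 y ≠ 0 → cosetMk A H y ∈ U

theorem SpaceWithFunctions.IsQuasiAffine.invariantsSeparate [IsAlgClosed k]
    (hA : IsAffineVariety A) (hq : (homogeneousSpace A H).IsQuasiAffine) :
    InvariantsSeparate A H := by
  obtain ⟨Y, B, -, φ, hφ, hreg⟩ := hq
  intro U hU x hx
  obtain ⟨b, hb, hbx, hbU⟩ := isOpen_zariskiTopology_iff.1 (hφ.isOpenMap U hU) (φ (cosetMk A H x))
    ⟨_, hx, rfl⟩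
  let V : Opens (SpaceWithFunctions.ofAffine B).carrier := ⟨Set.range φ, hφ.isOpen_range⟩
  have hbV : (fun y : V => b y.1) ∈ (SpaceWithFunctions.ofAffine B).regular V :=
    mem_regular_ofAffine_iff.2 fun _ => ⟨b, hb, 1, B.one_mem, one_ne_zero, fun _ => one_mul _⟩
  have hbφ := mem_regular_homogeneousSpace_iff.1 ((hreg V subset_rfl _).1 hbV)
  obtain ⟨n, f, hf⟩ := hA.exists_pow_mul_eq hbφ (c := 1) fun y _ => ⟨cosetMk A H y, rfl⟩
  replace hf (y : G) : f.1 y = b (φ (cosetMk A H y)) := by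
    simpa using (hf ⟨y, cosetMk A H y, rfl⟩).symm
  refine ⟨f, fun y h => by rw [hf, hf, cosetMk_mul], hf x ▸ hbx, fun y hy => ?_⟩
  obtain ⟨q, hq, hqy⟩ := hbU _ (hf y ▸ hy)
  exact hφ.injective hqy ▸ hq

theorem InvariantsSeparate.exists_inverse_semiinvariant [IsAlgClosed k] (hA : IsAffineVariety A)
    (hsep : InvariantsSeparate A H) {f : A} (hf1 : f.1 1 ≠ 0) {χ : H → k}
    (hf : ∀ (x : G) (h : H), f.1 (x * h) = f.1 x * χ h) :
    ∃ f' : A, f'.1 1 = 1 ∧ ∀ (x : G) (h : H), f'.1 (x * h) * χ h = f'.1 x := by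
  have hpre : cosetMk A H ⁻¹' (cosetMk A H '' {x | f.1 x ≠ 0}) = {x | f.1 x ≠ 0} := by
    refine (Set.subset_preimage_image _ _).antisymm' ?_
    rintro x ⟨y, hy, hyx⟩
    have hfy := hf x ⟨x⁻¹ * y, cosetMk_eq_iff.1 hyx.symm⟩
    rw [mul_inv_cancel_left] at hfy
    exact left_ne_zero_of_mul (ne_of_eq_of_ne hfy.symm hy)
  obtain ⟨g, hg, hg1, hgf⟩ := hsep (cosetMk A H '' {x | f.1 x ≠ 0})
    (isOpen_homogeneousSpace_iff.2 (by rw [hpre]; exact isOpen_zariskiTopology_ne_zero f.2))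
    1 ⟨1, hf1, rfl⟩
  replace hgf (x : G) (hx : g.1 x ≠ 0) : f.1 x ≠ 0 := hpre.subset (hgf x hx)
  obtain ⟨n, hn⟩ : g ∈ (Ideal.span {f}).radical := hA.mem_radical fun x hx => by
    by_contra hgx
    exact hgf x hgx (hx f (Ideal.mem_span_singleton_self f))
  obtain ⟨f₁, hf₁⟩ := Ideal.mem_span_singleton'.1 hn
  have hmul (x : G) : f₁.1 x * f.1 x = g.1 x ^ n := congrFun (congrArg Subtype.val hf₁) x
  have hf₁1 : f₁.1 1 ≠ 0 := left_ne_zero_of_mul (hmul 1 ▸ pow_ne_zero n hg1)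
  refine ⟨(g.1 1 * f₁.1 1)⁻¹ • (g * f₁), inv_mul_cancel₀ (mul_ne_zero hg1 hf₁1), fun x h => ?_⟩
  have key : g.1 x * f₁.1 (x * h) * χ h = g.1 x * f₁.1 x := by
    rcases eq_or_ne (g.1 x) 0 with hgx | hgx
    · simp [hgx]
    · have := hmul (x * h)
      rw [hg, ← hmul x, hf, mul_left_comm, mul_comm] at this
      rw [mul_assoc, mul_right_cancel₀ (hgf x hgx) this]
  change (g.1 1 * f₁.1 1)⁻¹ * (g.1 (x * h) * f₁.1 (x * h)) * χ h =
    (g.1 1 * f₁.1 1)⁻¹ * (g.1 x * f₁.1 x)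
  rw [hg, mul_assoc, key]

end HomogeneousSpace

section SchurComplement

variable {R n : Type*} [CommRing R] [Fintype n] [DecidableEq n] {q T P : Matrix n n R}

/-- If `q` is the projection onto the first block of `T = (T₁₁, T₁₂; T₂₁, T₂₂)`, this is the matrix
`(T₁₁, 0; T₂₁, 1)`. -/
def firstBlockColumn (q T : Matrix n n R) : Matrix n n R :=
  T * q + (1 - q)

/-- If `q` is the projection onto the first block of `T = (T₁₁, T₁₂; T₂₁, T₂₂)`, this is the Schur
complement `det T₁₁ • T₂₂ - T₂₁ * adj T₁₁ * T₁₂`, in the second diagonal block. -/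
def schurComplement (q T : Matrix n n R) : Matrix n n R :=
  (1 - q) * (firstBlockColumn q T).adjugate * T

theorem one_sub_mul_firstBlockColumn (hq : q * q = q) (hP : q * P * q = P * q) :
    (1 - q) * firstBlockColumn q P = 1 - q := by
  have : q * (P * q) = P * q := by rw [← mul_assoc, hP]
  simp only [firstBlockColumn, sub_mul, mul_add, mul_sub, one_mul, mul_one, this, hq]
  abel

theorem firstBlockColumn_mul_one_sub (hq : q * q = q) :
    firstBlockColumn q T * (1 - q) = 1 - q := by
  simp only [firstBlockColumn, add_mul, sub_mul, mul_sub, one_mul, mul_one, mul_assoc, hq]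
  abel

theorem firstBlockColumn_mul (hq : q * q = q) (hP : q * P * q = P * q) :
    firstBlockColumn q (T * P) = firstBlockColumn q T * firstBlockColumn q P := by
  have hqP : q * (P * q) = P * q := by rw [← mul_assoc, hP]
  conv_rhs => rw [firstBlockColumn, add_mul, one_sub_mul_firstBlockColumn hq hP]
  simp only [firstBlockColumn, mul_add, mul_sub, mul_one, mul_assoc, hqP, hq, sub_self, add_zero]

theorem schurComplement_one : schurComplement q 1 = 1 - q := by
  simp [schurComplement, firstBlockColumn]

theorem schurComplement_mul_self (hq : q * q = q) : schurComplement q T * q = 0 := by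
  set E := firstBlockColumn q T with hE
  have hTq : T * q = E - (1 - q) := by simp [hE, firstBlockColumn]
  have hadj : E.adjugate * (1 - q) = E.det • (1 - q) := by
    conv_lhs => rw [← firstBlockColumn_mul_one_sub (T := T) hq, ← mul_assoc, Matrix.adjugate_mul]
    simp
  have hidem : (1 - q) * (1 - q) = 1 - q := IsIdempotentElem.one_sub hq
  rw [schurComplement, mul_assoc, hTq, mul_assoc, mul_sub, hadj, Matrix.adjugate_mul, mul_sub,
    Matrix.mul_smul, Matrix.mul_smul, hidem, mul_one, sub_self]

theorem schurComplement_mul (hq : q * q = q) (hP : q * P * q = P * q) :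
    schurComplement q (T * P) = (firstBlockColumn q P).det • (schurComplement q T * P) := by
  have hadj : (1 - q) * (firstBlockColumn q P).adjugate =
      (firstBlockColumn q P).det • (1 - q) := by
    conv_lhs => rw [← one_sub_mul_firstBlockColumn hq hP, mul_assoc, Matrix.mul_adjugate]
    simp
  rw [schurComplement, firstBlockColumn_mul hq hP, Matrix.adjugate_mul_distrib, ← mul_assoc,
    ← mul_assoc, hadj]
  simp [schurComplement, mul_assoc]

end SchurComplement

section PolynomialMatrices

variable {k : Type u} [Field k] {X : Type*} {A : Subalgebra k (X → k)} {n : Type*}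

namespace polynomialMaps

theorem mem_matrix_iff [Finite n] {F : X → Matrix n n k} :
    F ∈ polynomialMaps A (Matrix n n k) ↔ ∀ i j, (fun x => F x i j) ∈ A :=
  ⟨fun hF i j => mem_self_iff.1 (map_mem hF (Matrix.entryLinearMap k k i j)),
    fun hF => pi_mem fun i => pi_mem fun j => mem_self_iff.2 (hF i j)⟩

theorem exists_map_eval_eq [Finite n] {F : X → Matrix n n k}
    (hF : F ∈ polynomialMaps A (Matrix n n k)) :
    ∃ F' : Matrix n n A, ∀ x, F x = F'.map fun f => f.1 x :=
  ⟨.of fun i j => ⟨_, mem_matrix_iff.1 hF i j⟩, fun _ => rfl⟩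

variable [Fintype n] [DecidableEq n]

theorem det_mem {F : X → Matrix n n k} (hF : F ∈ polynomialMaps A (Matrix n n k)) :
    (fun x => (F x).det) ∈ A := by
  obtain ⟨F', hF'⟩ := exists_map_eval_eq hF
  have : (fun x => (F x).det) = F'.det.1 := funext fun x => by
    rw [hF']
    exact (((Pi.evalRingHom (fun _ : X => k) x).comp A.val.toRingHom).map_det F').symm
  exact this ▸ F'.det.2

theorem adjugate_mem {F : X → Matrix n n k} (hF : F ∈ polynomialMaps A (Matrix n n k)) :
    (fun x => (F x).adjugate) ∈ polynomialMaps A (Matrix n n k) := by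
  obtain ⟨F', hF'⟩ := exists_map_eval_eq hF
  refine mem_matrix_iff.2 fun i j => ?_
  have : (fun x => (F x).adjugate i j) = (F'.adjugate i j).1 := funext fun x => by
    rw [hF']
    exact (congrFun₂ (((Pi.evalRingHom (fun _ : X => k) x).comp A.val.toRingHom).map_adjugate F')
      i j).symm
  exact this ▸ (F'.adjugate i j).2

theorem firstBlockColumn_mem {F : X → Matrix n n k} (hF : F ∈ polynomialMaps A (Matrix n n k))
    (q : Matrix n n k) :
    (fun x => firstBlockColumn q (F x)) ∈ polynomialMaps A (Matrix n n k) :=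
  add_mem (map_mem hF (LinearMap.mulRight k q)) (by simpa using smul_mem A.one_mem (1 - q))

theorem schurComplement_mem {F : X → Matrix n n k} (hF : F ∈ polynomialMaps A (Matrix n n k))
    (q : Matrix n n k) :
    (fun x => schurComplement q (F x)) ∈ polynomialMaps A (Matrix n n k) :=
  map₂_mem (map_mem (adjugate_mem (firstBlockColumn_mem hF q)) (LinearMap.mulLeft k (1 - q))) hF
    (LinearMap.mul k _)

end polynomialMaps

end PolynomialMatrices

section RepresentationsOfSubgroup

variable {k : Type u} [Field k] {G : Type v} [Group G] {A : Subalgebra k (G → k)} {H : Subgroup G}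

theorem InvariantsSeparate.exists_equivariant_vanishing_on [IsAlgClosed k]
    (hA : IsAffineVariety A) (hsep : InvariantsSeparate A H) {V : Type*} [AddCommGroup V]
    [Module k V] [FiniteDimensional k V] {ρ : Representation k G V}
    (hρ : IsRationalRepresentation A ρ) {W : Submodule k V} (hW : ∀ h : H, W ≤ W.comap (ρ h)) :
    ∃ s ∈ polynomialMaps A (Module.End k V), (∀ (x : G) (h : H), s (x * h) = s x * ρ h) ∧
      (∀ x, ∀ w ∈ W, s x w = 0) ∧ ∀ v, s 1 v - v ∈ W := by
  obtain ⟨C, hC⟩ := W.exists_isCompl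
  let e := LinearMap.toMatrixAlgEquiv (Module.finBasis k V)
  let c (x : G) := e (ρ x)
  have hc : c ∈ polynomialMaps A (Matrix _ _ k) :=
    polynomialMaps.map_mem hρ.mem_polynomialMaps e.toLinearMap
  have hcmul (x y : G) : c (x * y) = c x * c y := by simp [c]
  let π : Module.End k V := W.projection C hC
  have hπW {w : V} (hw : w ∈ W) : π w = w := Submodule.projection_apply_of_mem_left hC hw
  have hπ (v : V) : π v ∈ W := Submodule.projection_apply_mem hC v
  let q := e π
  have hq : q * q = q := by
    rw [← map_mul]
    exact congrArg e (LinearMap.ext fun v => hπW (hπ v))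
  have hqc (h : H) : q * c h * q = c h * q := by
    rw [← map_mul, ← map_mul, ← map_mul]
    exact congrArg e (LinearMap.ext fun v => hπW (hW h (hπ v)))
  obtain ⟨f, hf1, hf⟩ := hsep.exists_inverse_semiinvariant hA
    (f := ⟨_, polynomialMaps.det_mem (polynomialMaps.firstBlockColumn_mem hc q)⟩)
    (χ := fun h => (firstBlockColumn q (c h)).det) (by simp [c, firstBlockColumn])
    (fun x h => by simp only [hcmul, firstBlockColumn_mul hq (hqc h), Matrix.det_mul])
  refine ⟨fun x => e.symm (f.1 x • schurComplement q (c x)), ?_, fun x h => e.injective ?_,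
    fun x w hw => ?_, fun v => ?_⟩
  · exact polynomialMaps.map_mem (polynomialMaps.map₂_mem (polynomialMaps.mem_self_iff.2 f.2)
      (polynomialMaps.schurComplement_mem hc q) (LinearMap.lsmul k _)) e.symm.toLinearMap
  · simp only [e.apply_symm_apply, map_mul, hcmul, schurComplement_mul hq (hqc h), smul_smul, hf,
      Matrix.smul_mul, c]
  · have hvanish : e.symm (f.1 x • schurComplement q (c x)) * π = 0 := e.injective (by
      simp [schurComplement_mul_self hq, q])
    simpa [hπW hw] using LinearMap.congr_fun hvanish w
  · have hone : e.symm (f.1 1 • schurComplement q (c 1)) = 1 - π := by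
      simp [c, hf1, schurComplement_one, q]
    simpa [hone] using hπ v

theorem InvariantsSeparate.extendsEquivariantly_of_subquotient [IsAlgClosed k]
    (hA : IsAffineVariety A) (hsep : InvariantsSeparate A H) {M V : Type*}
    [AddCommGroup M] [Module k M] [AddCommGroup V] [Module k V] [FiniteDimensional k M]
    [FiniteDimensional k V] {σ : Representation k H M} {ρ : Representation k G V}
    (hρ : IsRationalRepresentation A ρ) {W : Submodule k V} (hW : ∀ h : H, W ≤ W.comap (ρ h))
    {j : M →ₗ[k] V} (hj : ∀ m, j m ∈ W → m = 0) (hjσ : ∀ h m, j (σ h m) - ρ h (j m) ∈ W) :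
    ExtendsEquivariantly A σ := by
  obtain ⟨s, hs, hsmul, hsW, hs1⟩ := hsep.exists_equivariant_vanishing_on hA hρ hW
  obtain ⟨r', hr'⟩ := (W.mkQ ∘ₗ j).exists_leftInverse_of_injective <|
    LinearMap.ker_eq_bot'.2 fun m hm => hj m ((Submodule.Quotient.mk_eq_zero W).1 hm)
  let r := r' ∘ₗ W.mkQ
  have hrW {v w : V} (hvw : v - w ∈ W) : r v = r w :=
    congrArg r' ((Submodule.Quotient.eq W).2 hvw)
  refine ⟨fun x => r ∘ₗ s x ∘ₗ j, polynomialMaps.linearMap_mem fun m =>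
    polynomialMaps.map_mem hs (r ∘ₗ LinearMap.applyₗ (j m)), LinearMap.ext fun m => ?_,
    fun x h => LinearMap.ext fun m => ?_⟩
  · exact (hrW (hs1 (j m))).trans (LinearMap.congr_fun hr' m)
  · have := hsW x _ (hjσ h m)
    rw [map_sub, sub_eq_zero] at this
    simp [hsmul, this]

theorem InvariantsSeparate.extendsEquivariantly [IsAlgClosed k]
    (hA : IsAffineAlgebraicGroup A) (hsep : InvariantsSeparate A H) {M : Type*} [AddCommGroup M]
    [Module k M] [FiniteDimensional k M] {σ : Representation k H M}
    (hσ : IsRationalRepresentation (restrictFunctions A (H : Set G)) σ) :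
    ExtendsEquivariantly A σ := by
  obtain ⟨s, hs, hsσ⟩ := polynomialMaps.exists_restrict_eq hσ.mem_polynomialMaps
  let j : M →ₗ[k] polynomialMaps A M :=
    { toFun := fun m => ⟨fun x => s x m, polynomialMaps.map_mem hs (LinearMap.applyₗ m)⟩
      map_add' := fun _ _ => by ext; simp
      map_smul' := fun _ _ => by ext; simp }
  have hρ := hA.isRationalRepresentation_polynomialMapsRegular M
  obtain ⟨V, _, hV, hj⟩ := hρ.exists_stable_finiteDimensional_forall_mem j
  let W : Submodule k V :=
    { carrier := {F | ∀ h : H, F.1.1 h = 0}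
      zero_mem' := fun h => rfl
      add_mem' := fun hF hF' h => by simp [hF h, hF' h]
      smul_mem' := fun c F hF h => by simp [hF h] }
  refine hsep.extendsEquivariantly_of_subquotient hA.toIsAffineVariety (hρ.subrepresentation hV)
    (W := W) (fun h F hF h' => hF (h' * h)) (j := j.codRestrict V hj) (fun m hm => ?_)
    fun h m h' => ?_
  · have : s 1 = 1 := by simpa using hsσ 1
    simpa [j, this] using hm 1
  · have : s (h' * h) = σ (h' * h) := hsσ (h' * h)
    simp [j, hsσ h', this]

theorem InvariantsSeparate.isObservable [IsAlgClosed k] (hA : IsAffineAlgebraicGroup A)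
    (hsep : InvariantsSeparate A H) : IsObservable A H :=
  .of_extendsEquivariantly hA fun _ _ _ _ _ hσ => hsep.extendsEquivariantly hA hσ

end RepresentationsOfSubgroup

section InvariantsOfObservable

variable {k : Type u} [Field k] {G : Type v} [Group G] {A : Subalgebra k (G → k)} {H : Subgroup G}

theorem IsAffineAlgebraicGroup.leftTranslate_mem_invariantFunctions
    (hA : IsAffineAlgebraicGroup A) (g : G) {f : A} (hf : f ∈ invariantFunctions A H) :
    hA.leftTranslate g f ∈ invariantFunctions A H := fun x h => by
  simp [← mul_assoc, hf (g * x) h]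

variable (A) in
/-- The ideal of `k[G]` of the functions that vanish on `S`, for an arbitrary subset `S` of `G`. -/
def vanishingIdealOn (S : Set G) : Ideal A where
  carrier := {f | ∀ x ∈ S, f.1 x = 0}
  zero_mem' _ _ := rfl
  add_mem' hf hg x hx := by simp [hf x hx, hg x hx]
  smul_mem' c f hf x hx := by simp [hf x hx]

theorem IsAffineAlgebraicGroup.rightTranslate_mem_vanishingIdealOn (hA : IsAffineAlgebraicGroup A)
    {S : Set G} {g : G} (hS : ∀ x ∈ S, x * g ∈ S) {f : A} (hf : f ∈ vanishingIdealOn A S) :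
    hA.rightTranslate g f ∈ vanishingIdealOn A S :=
  fun x hx => hf _ (hS x hx)

theorem IsObservable.extendsEquivariantly_dual (hobs : IsObservable A H)
    (hA : IsAffineAlgebraicGroup A) {M : Type*} [AddCommGroup M] [Module k M]
    [FiniteDimensional k M] {σ : Representation k H M}
    (hσ : IsRationalRepresentation (restrictFunctions A (H : Set G)) σ) :
    ExtendsEquivariantly A σ.dual := by
  refine hobs.extendsEquivariantly (hσ.dual ?_)
  rintro _ ⟨f, hf, rfl⟩
  exact ⟨_, hA.inv_mem' f hf, rfl⟩

theorem IsObservable.exists_invariant_sub_mem_of_equivariant (hobs : IsObservable A H)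
    (hA : IsAffineAlgebraicGroup A) {M : Type*} [AddCommGroup M] [Module k M]
    [FiniteDimensional k M] {σ : Representation k H M}
    (hσ : IsRationalRepresentation (restrictFunctions A (H : Set G)) σ) {ι : M →ₗ[k] A}
    (hι : ∀ (h : H) (m : M), ι (σ h m) = hA.rightTranslate h (ι m)) {J : Ideal A}
    (hιJ : ∀ m, ι m ∈ J) (u : M) :
    ∃ F ∈ invariantFunctions A H, F - ι u ∈ vanishingIdealOn A {1} * J := by
  obtain ⟨a, ha, ha1, hmul⟩ := hobs.extendsEquivariantly_dual hA hσ
  let ev (x : G) : Module.Dual k M :=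
    ((Pi.evalAlgHom k (fun _ : G => k) x).comp A.val).toLinearMap ∘ₗ ι
  have hev (x : G) (h : H) : σ.dual h (ev (x * h)) = ev x := by
    ext m
    simp [ev, Representation.dual_apply, Module.Dual.transpose_apply, hι]
  let b := Module.finBasis k M
  let c (i) : A := ⟨fun x => a x (b.coord i) u, polynomialMaps.mem_self_iff.1
    (polynomialMaps.map_mem ha (LinearMap.applyₗ u ∘ₗ LinearMap.applyₗ (b.coord i)))⟩
  let F : A := ∑ i, c i * ι (b i)
  have hF (x : G) : F.1 x = a x (ev x) u := by
    have hFx : F.1 x = ∑ i, a x (b.coord i) u * (ι (b i)).1 x := by simp [F, c]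
    rw [hFx, ← b.sum_dual_apply_smul_coord (ev x)]
    simp [ev, mul_comm]
  refine ⟨F, fun x h => ?_, ?_⟩
  · rw [hF, hF, hmul, Module.End.mul_apply, hev]
  · have hu : ι u = ∑ i, algebraMap k A ((c i).1 1) * ι (b i) := by
      have hcoord (i) : (c i).1 1 = b.repr u i := by simp [c, ha1]
      simp only [hcoord, ← Algebra.smul_def, ← map_smul, ← map_sum, b.sum_repr]
    rw [hu, ← Finset.sum_sub_distrib]
    refine Ideal.sum_mem _ fun i _ => ?_
    rw [← sub_mul]
    exact Ideal.mul_mem_mul (by simp [vanishingIdealOn]) (hιJ (b i))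

theorem IsObservable.exists_invariant_sub_mem (hobs : IsObservable A H)
    (hA : IsAffineAlgebraicGroup A) {J : Ideal A}
    (hJ : ∀ (h : H), ∀ f ∈ J, hA.rightTranslate h f ∈ J) {u : A} (hu : u ∈ J) :
    ∃ F ∈ invariantFunctions A H, F - u ∈ vanishingIdealOn A {1} * J := by
  have hrat := hA.isRationalRepresentation_rightRegular.comp_subtype H
  obtain ⟨U, _, hU, huU, hUmin⟩ := hrat.exists_stable_finiteDimensional (Set.finite_singleton u)
  have hUJ : U ≤ J.restrictScalars k := hUmin _ (Set.singleton_subset_iff.2 hu) hJ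
  exact hobs.exists_invariant_sub_mem_of_equivariant hA (hrat.subrepresentation hU)
    (ι := U.subtype) (fun _ _ => rfl) (fun m => hUJ m.2) ⟨u, huU rfl⟩

theorem IsObservable.exists_invariant_mem (hobs : IsObservable A H) (hA : IsAffineAlgebraicGroup A)
    {J : Ideal A} (hJ : ∀ (h : H), ∀ f ∈ J, hA.rightTranslate h f ∈ J) {u : A} (hu : u ∈ J) :
    ∃ F ∈ invariantFunctions A H, F ∈ J ∧ F.1 1 = u.1 1 ∧ F - u ∈ vanishingIdealOn A {1} * J := by
  obtain ⟨F, hF, hFu⟩ := hobs.exists_invariant_sub_mem hA hJ hu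
  obtain ⟨hF1, hFJ⟩ := Ideal.mul_le_inf hFu
  exact ⟨F, hF, by simpa using J.add_mem hFJ hu, sub_eq_zero.1 (hF1 1 rfl), hFu⟩

theorem IsObservable.invariantsSeparate (hobs : IsObservable A H)
    (hA : IsAffineAlgebraicGroup A) : InvariantsSeparate A H := by
  intro U hU x₀ hx₀
  obtain ⟨u, hu, hu0, huU⟩ := isOpen_zariskiTopology_iff.1 (isOpen_homogeneousSpace_iff.1 hU) x₀ hx₀
  let J := vanishingIdealOn A {x | cosetMk A H (x₀ * x) ∉ U}
  have huJ : hA.leftTranslate x₀ ⟨u, hu⟩ ∈ J := fun x hx => by_contra fun hne => hx (huU _ hne)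
  have hJ (h : H) : ∀ f ∈ J, hA.rightTranslate h f ∈ J := fun f =>
    hA.rightTranslate_mem_vanishingIdealOn fun x hx => by
      simpa only [Set.mem_ofPred_eq, ← mul_assoc, cosetMk_mul] using hx
  obtain ⟨F, hF, hFJ, hF1, -⟩ := hobs.exists_invariant_mem hA hJ huJ
  refine ⟨_, hA.leftTranslate_mem_invariantFunctions x₀⁻¹ hF, ?_, fun y hy => ?_⟩
  · simpa [hF1] using hu0
  · by_contra hyU
    exact hy (hFJ _ (by simpa using hyU))

theorem IsObservable.exists_finite_vanishingIdealOn_le_sup (hobs : IsObservable A H)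
    (hA : IsAffineAlgebraicGroup A) :
    ∃ F : Set A, F.Finite ∧ F ⊆ invariantFunctions A H ∧ F ⊆ vanishingIdealOn A (H : Set G) ∧
      vanishingIdealOn A (H : Set G) ≤
        Ideal.span F ⊔ vanishingIdealOn A {1} * vanishingIdealOn A (H : Set G) := by
  have : Algebra.FiniteType k A := A.fg_iff_finiteType.mp hA.fg
  have : IsNoetherianRing A := Algebra.FiniteType.isNoetherianRing k A
  obtain ⟨S, hS⟩ := IsNoetherian.noetherian (vanishingIdealOn A (H : Set G))
  have hSI (u : S) : u.1 ∈ vanishingIdealOn A (H : Set G) :=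
    hS.le (Submodule.subset_span u.2)
  choose F hF hFI _ hFsub using fun u : S => hobs.exists_invariant_mem hA
    (fun (h : H) _ => hA.rightTranslate_mem_vanishingIdealOn fun _ hx => H.mul_mem hx h.2) (hSI u)
  refine ⟨Set.range F, Set.finite_range F, Set.range_subset_iff.2 hF, Set.range_subset_iff.2 hFI,
    hS.ge.trans (Submodule.span_le.2 fun u hu => ?_)⟩
  have := Submodule.sub_mem_sup (Submodule.subset_span (Set.mem_range_self (f := F) ⟨u, hu⟩))
    (hFsub ⟨u, hu⟩)
  rwa [sub_sub_cancel] at this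

theorem IsObservable.exists_local_generators (hobs : IsObservable A H)
    (hA : IsAffineAlgebraicGroup A) :
    ∃ F : Set A, F.Finite ∧ F ⊆ invariantFunctions A H ∧ F ⊆ vanishingIdealOn A (H : Set G) ∧
      ∃ b ∈ invariantFunctions A H, b.1 1 ≠ 0 ∧
        ∀ f ∈ vanishingIdealOn A (H : Set G), b * f ∈ Ideal.span F := by
  have : Algebra.FiniteType k A := A.fg_iff_finiteType.mp hA.fg
  have : IsNoetherianRing A := Algebra.FiniteType.isNoetherianRing k A
  obtain ⟨F, hFfin, hF, hFI, hle⟩ := hobs.exists_finite_vanishingIdealOn_le_sup hA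
  obtain ⟨r, hr1, hr⟩ := Submodule.exists_sub_one_mem_and_smul_le_of_fg_of_le_sup
    (IsNoetherian.noetherian (vanishingIdealOn A (H : Set G))) le_rfl hle
  let J := (Ideal.span F).colon (vanishingIdealOn A (H : Set G) : Set A)
  have hrJ : r ∈ J :=
    Submodule.mem_colon.2 fun f hf => hr (Submodule.smul_mem_pointwise_smul f r _ hf)
  have hFstab (h : H) : Ideal.span F ≤ (Ideal.span F).comap (hA.rightTranslate h) :=
    Ideal.span_le.2 fun f hf => by
      have : hA.rightTranslate h f = f := Subtype.ext (funext fun x => hF hf x h)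
      rw [SetLike.mem_coe, Ideal.mem_comap, this]
      exact Ideal.subset_span hf
  have hJ (h : H) : ∀ f ∈ J, hA.rightTranslate h f ∈ J := fun f hf =>
    Submodule.mem_colon.2 fun g hg => by
      have := hFstab h <| Submodule.mem_colon.1 hf _ <|
        hA.rightTranslate_mem_vanishingIdealOn (fun x hx => H.mul_mem hx (h⁻¹).2) hg
      rw [Ideal.mem_comap, smul_eq_mul, map_mul] at this
      convert this
      ext x
      simp
  obtain ⟨b, hb, hbJ, hb1, -⟩ := hobs.exists_invariant_mem hA hJ hrJ
  refine ⟨F, hFfin, hF, hFI, b, hb, ?_, Submodule.mem_colon.1 hbJ⟩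
  rw [hb1, sub_eq_zero.1 (hr1 1 rfl)]
  exact one_ne_zero

end InvariantsOfObservable

section CommutativeAlgebra

open scoped TensorProduct

theorem mem_range_algebraMap_of_tmul_one_eq {K L : Type*} [Field K] [CommRing L] [Algebra K L]
    {f : L} (hf : f ⊗ₜ[K] (1 : L) = 1 ⊗ₜ f) : f ∈ Set.range (algebraMap K L) := by
  cases subsingleton_or_nontrivial L
  · exact ⟨0, Subsingleton.elim _ _⟩
  · rw [← (Algebra.IsEffective.of_faithfullyFlat K L).eqLocus_includeLeft_includeRight]
    exact hf

theorem tmul_one_eq_one_tmul_map {R S K L : Type*} [CommRing R] [CommRing S] [CommRing K]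
    [CommRing L] [Algebra R S] [Algebra R K] [Algebra K L] [Algebra R L] [IsScalarTower R K L]
    (φ : S →ₐ[R] L) {f : S} (hf : f ⊗ₜ[R] (1 : S) = 1 ⊗ₜ f) : φ f ⊗ₜ[K] (1 : L) = 1 ⊗ₜ φ f := by
  let i₁ : L →ₐ[R] L ⊗[K] L :=
    (Algebra.TensorProduct.includeLeft : L →ₐ[K] L ⊗[K] L).restrictScalars R
  let i₂ : L →ₐ[R] L ⊗[K] L :=
    (Algebra.TensorProduct.includeRight : L →ₐ[K] L ⊗[K] L).restrictScalars R
  have h := congrArg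
    (Algebra.TensorProduct.lift (i₁.comp φ) (i₂.comp φ) fun _ _ => Commute.all _ _) hf
  rwa [Algebra.TensorProduct.lift_tmul, Algebra.TensorProduct.lift_tmul, map_one, map_one, mul_one,
    one_mul] at h

variable {R S : Type*} [CommRing R] [IsReduced R] [CommRing S] [Algebra R S] {p : Ideal R}

theorem isField_localization_atPrime_of_mem_minimalPrimes (hp : p ∈ minimalPrimes R) :
    haveI := hp.1.1
    IsField (Localization.AtPrime p) := by
  have := hp.1.1
  have := Ring.KrullDimLE.of_isLocalization p hp (Localization.AtPrime p)
  have : IsReduced (Localization.AtPrime p) :=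
    isReduced_localizationPreserves p.primeCompl (Localization.AtPrime p) inferInstance
  exact Ring.KrullDimLE.isField_of_isReduced

theorem exists_notMem_mul_eq_zero_of_mem_minimalPrimes (hp : p ∈ minimalPrimes R)
    {g : R} (hg : g ∈ p) : ∃ t ∉ p, t * g = 0 := by
  have := hp.1.1
  let : Field (Localization.AtPrime p) :=
    (isField_localization_atPrime_of_mem_minimalPrimes hp).toField
  have h0 : algebraMap R (Localization.AtPrime p) g = 0 := by
    by_contra hne
    exact (IsLocalization.AtPrime.isUnit_to_map_iff (Localization.AtPrime p) p g).1
      (isUnit_iff_ne_zero.2 hne) hg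
  obtain ⟨t, ht⟩ := (IsLocalization.map_eq_zero_iff p.primeCompl _ g).1 h0
  exact ⟨t, t.2, ht⟩

/- Over the field `R_p` an element of the kernel of `L ⇉ L ⊗ L` is a scalar; clear denominators. -/
theorem exists_smul_mem_range_of_tmul_one_eq (hp : p ∈ minimalPrimes R)
    {f : S} (hf : f ⊗ₜ[R] (1 : S) = 1 ⊗ₜ f) :
    ∃ s ∉ p, s • f ∈ Set.range (algebraMap R S) := by
  have := hp.1.1
  let M := p.primeCompl
  let K := Localization.AtPrime p
  let L := Localization (Algebra.algebraMapSubmonoid S M)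
  let : Field K := (isField_localization_atPrime_of_mem_minimalPrimes hp).toField
  obtain ⟨c, hc⟩ := mem_range_algebraMap_of_tmul_one_eq (K := K)
    (tmul_one_eq_one_tmul_map (IsScalarTower.toAlgHom R S L) hf)
  obtain ⟨⟨r, s⟩, hrs⟩ := IsLocalization.surj M c
  have hsr : algebraMap S L (s.1 • f) = algebraMap S L (algebraMap R S r) := by
    rw [← IsScalarTower.algebraMap_apply, IsScalarTower.algebraMap_apply R K L, ← hrs, map_mul, hc,
      ← IsScalarTower.algebraMap_apply, Algebra.smul_def, map_mul, ← IsScalarTower.algebraMap_apply,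
      mul_comm]
    rfl
  obtain ⟨⟨_, t, ht, rfl⟩, hte⟩ :=
    (IsLocalization.eq_iff_exists (Algebra.algebraMapSubmonoid S M) L).1 hsr
  refine ⟨t * s, M.mul_mem ht s.2, t * r, ?_⟩
  rw [map_mul, mul_smul, Algebra.smul_def t]
  exact hte.symm

theorem exists_basicOpen_subset_of_isConstructible (hp : p ∈ minimalPrimes R)
    {Z : Set (PrimeSpectrum R)} (hZ : Topology.IsConstructible Z) (hpZ : ⟨p, hp.1.1⟩ ∈ Z) :
    ∃ s ∉ p, (PrimeSpectrum.basicOpen s : Set (PrimeSpectrum R)) ⊆ Z := by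
  have := hp.1.1
  obtain ⟨D, rfl⟩ := PrimeSpectrum.exists_constructibleSetData_iff.2 hZ
  simp only [PrimeSpectrum.ConstructibleSetData.toSet, Set.mem_iUnion₂] at hpZ
  obtain ⟨C, hC, hg, hf⟩ := hpZ
  choose t htp ht using fun i =>
    exists_notMem_mul_eq_zero_of_mem_minimalPrimes hp (hg ⟨i, rfl⟩ : C.g i ∈ p)
  rw [PrimeSpectrum.mem_zeroLocus, Set.singleton_subset_iff] at hf
  refine ⟨C.f * ∏ i, t i, p.primeCompl.mul_mem hf (p.primeCompl.prod_mem fun i _ => htp i),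
    fun q hq => Set.mem_iUnion₂.2 ⟨C, hC, ?_, fun h => hq ?_⟩⟩
  · rintro _ ⟨i, rfl⟩
    refine (q.2.mem_or_mem (show t i * C.g i ∈ q.asIdeal by rw [ht]; exact zero_mem _)
      ).resolve_left fun h => hq ?_
    exact Ideal.mul_mem_left _ _
      (Ideal.mem_of_dvd _ (Finset.dvd_prod_of_mem t (Finset.mem_univ i)) h)
  · exact Ideal.mul_mem_right _ _ (h rfl)

theorem exists_basicOpen_subset_range_comap (hp : p ∈ minimalPrimes R)
    [Algebra.FinitePresentation R S] (hinj : Function.Injective (algebraMap R S)) :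
    ∃ s ∉ p, (PrimeSpectrum.basicOpen s : Set (PrimeSpectrum R)) ⊆
      Set.range (PrimeSpectrum.comap (algebraMap R S)) := by
  obtain ⟨q, hq, hqp⟩ := Ideal.exists_comap_eq_of_mem_minimalPrimes_of_injective hinj p hp
  exact exists_basicOpen_subset_of_isConstructible hp
    (PrimeSpectrum.isConstructible_range_comap
      (RingHom.finitePresentation_algebraMap.mpr ‹Algebra.FinitePresentation R S›))
    ⟨⟨q, hq⟩, PrimeSpectrum.ext hqp⟩

end CommutativeAlgebra

section Descent

open scoped TensorProduct

variable {k : Type u} [Field k]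

section TensorToFun

variable {X Y : Type*} (A : Subalgebra k (X → k)) (B : Subalgebra k (Y → k))

/-- The tensor product of algebras of functions on `X` and on `Y`, evaluated on `X × Y`. -/
noncomputable def tensorToFun : A ⊗[k] B →ₐ[k] (X × Y → k) :=
  Algebra.TensorProduct.lift
    ((AlgHom.pi fun p : X × Y => Pi.evalAlgHom k (fun _ : X => k) p.1).comp A.val)
    ((AlgHom.pi fun p : X × Y => Pi.evalAlgHom k (fun _ : Y => k) p.2).comp B.val)
    fun _ _ => Commute.all _ _

variable {A B}

@[simp]
theorem tensorToFun_tmul (f : A) (g : B) (x : X) (y : Y) :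
    tensorToFun A B (f ⊗ₜ g) (x, y) = f.1 x * g.1 y := by
  simp [tensorToFun]

variable (A B) in
theorem tensorToFun_injective : Function.Injective (tensorToFun A B) := by
  classical
  rw [injective_iff_map_eq_zero]
  intro t ht
  let b := Module.Basis.ofVectorSpace k B
  obtain ⟨c, rfl⟩ := (TensorProduct.equivFinsuppOfBasisRight (M := A) b).symm.surjective t
  suffices hc : ∀ i x, (c i).1 x = 0 by
    have : c = 0 := by ext i x; exact hc i x
    simp [this]
  intro i x
  have hsum : ∑ j ∈ c.support, (c j).1 x • b j = 0 := by
    ext y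
    simpa [Finsupp.sum] using congrFun ht (x, y)
  by_cases hi : i ∈ c.support
  · exact linearIndependent_iff'.1 b.linearIndependent c.support _ hsum i hi
  · simp [Finsupp.notMem_support_iff.1 hi]

end TensorToFun

variable {G : Type v} [Group G] {A : Subalgebra k (G → k)} {H : Subgroup G}

namespace IsAffineAlgebraicGroup

variable (hA : IsAffineAlgebraicGroup A)
include hA

theorem exists_tensor_inv_mul :
    ∃ Δ : A →ₐ[k] A ⊗[k] A, ∀ f x y, tensorToFun A A (Δ f) (x, y) = f.1 (x⁻¹ * y) := by
  let c : A →ₐ[k] (G × G → k) :=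
    (AlgHom.pi fun p : G × G => Pi.evalAlgHom k (fun _ : G => k) (p.1⁻¹ * p.2)).comp A.val
  have hc (f : A) : c f ∈ (tensorToFun A A).range := by
    obtain ⟨n, p, q, h⟩ := hA.exists_coproduct f
    refine ⟨∑ i, pullback _ hA.inv_mem' (p i) ⊗ₜ q i, funext fun ⟨x, y⟩ => ?_⟩
    simp [c, h]
  refine ⟨(AlgEquiv.ofInjective _ (tensorToFun_injective A A)).symm.toAlgHom.comp
    (c.codRestrict _ hc), fun f x y => ?_⟩
  exact congrFun (congrArg Subtype.val ((AlgEquiv.ofInjective _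
    (tensorToFun_injective A A)).apply_symm_apply (c.codRestrict _ hc f))) (x, y)

/- The point `θ = i₁⁻¹ * i₂` of `G` with values in `T`, and the identity `i₂ = i₁ * θ`. -/
theorem exists_inv_mul_point {T : Type*} [CommRing T] [Algebra k T] (i₁ i₂ : A →ₐ[k] T) :
    ∃ θ : A →ₐ[k] T, ∀ (f : A) (n : ℕ) (p q : Fin n → A),
      (∀ x y, f.1 (x * y) = ∑ i, (p i).1 x * (q i).1 y) →
        θ f = ∑ i, i₁ (pullback _ hA.inv_mem' (p i)) * i₂ (q i) ∧
        i₂ f = ∑ i, i₁ (p i) * θ (q i) := by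
  obtain ⟨Δ, hΔ⟩ := hA.exists_tensor_inv_mul
  let ψ : A ⊗[k] A →ₐ[k] T := Algebra.TensorProduct.lift i₁ i₂ fun _ _ => Commute.all _ _
  refine ⟨ψ.comp Δ, fun f n p q h => ⟨?_, ?_⟩⟩
  · have hΔf : Δ f = ∑ i, pullback _ hA.inv_mem' (p i) ⊗ₜ q i :=
      tensorToFun_injective A A (funext fun ⟨x, y⟩ => by simp [hΔ, h])
    simp [hΔf, ψ]
  · have hf : (1 : A) ⊗ₜ[k] f = ∑ i, (p i ⊗ₜ 1) * Δ (q i) :=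
      tensorToFun_injective A A (funext fun ⟨x, y⟩ => by
        simpa [hΔ] using h x (x⁻¹ * y))
    simpa [ψ] using congrArg ψ hf

/- Two points `i₁`, `i₂` of `G` with values in `T` that agree on `B` differ by a point `θ` that is
trivial on `B`; as `B` generates the ideal of `H` near `1`, the point `θ` lies in `H`, and then
invariant functions do not distinguish `i₁` from `i₂`. -/
theorem algHom_eqOn_invariantFunctions {B : Subalgebra k A}
    (hB : ∀ g, ∀ f ∈ B, hA.leftTranslate g f ∈ B)
    {F : Set A} (hFB : F ⊆ B) (hF : F ⊆ vanishingIdealOn A (H : Set G))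
    {b : A} (hbB : b ∈ B) (hb1 : b.1 1 ≠ 0)
    (hgen : ∀ f ∈ vanishingIdealOn A (H : Set G), b * f ∈ Ideal.span F)
    {T : Type*} [CommRing T] [Algebra k T] {i₁ i₂ : A →ₐ[k] T} (hi : ∀ f ∈ B, i₁ f = i₂ f)
    {f : A} (hf : f ∈ invariantFunctions A H) : i₁ f = i₂ f := by
  obtain ⟨θ, hθ⟩ := hA.exists_inv_mul_point i₁ i₂
  have hθB : ∀ f ∈ B, θ f = algebraMap k T (f.1 1) := by
    intro f hf
    obtain ⟨n, p, q, hq, hpq⟩ := hA.exists_coproduct_mem (P := Subalgebra.toSubmodule B) hB hf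
    have hf1 : ∑ i, pullback _ hA.inv_mem' (p i) * q i = algebraMap k A (f.1 1) := by
      ext x
      simpa using (hpq x⁻¹ x).symm
    rw [(hθ f n p q hpq).1, ← i₁.commutes, ← hf1, map_sum]
    exact Finset.sum_congr rfl fun i _ => by rw [map_mul, hi _ (hq i)]
  have hθH : ∀ s ∈ vanishingIdealOn A (H : Set G), θ s = 0 := by
    intro s hs
    have hF0 : Ideal.span F ≤ RingHom.ker θ := Ideal.span_le.2 fun s hs => by
      rw [SetLike.mem_coe, RingHom.mem_ker, hθB _ (hFB hs), hF hs 1 H.one_mem, map_zero]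
    have hbs : b.1 1 • θ s = 0 := by
      rw [Algebra.smul_def, ← hθB b hbB, ← map_mul]
      exact hF0 (hgen s hs)
    exact (smul_eq_zero.1 hbs).resolve_left hb1
  have hθinv : ∀ q ∈ invariantFunctions A H, θ q = algebraMap k T (q.1 1) := by
    intro q hq
    rw [← θ.commutes, ← sub_eq_zero, ← map_sub]
    refine hθH _ fun h hh => ?_
    simpa [sub_eq_zero] using hq 1 ⟨h, hh⟩
  obtain ⟨n, p, q, hq, hpq⟩ := hA.exists_coproduct_mem
    (P := Subalgebra.toSubmodule (invariantFunctions A H))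
    (fun g _ => hA.leftTranslate_mem_invariantFunctions g) hf
  have hf1 : f = ∑ i, (q i).1 1 • p i := by
    ext x
    simpa [mul_comm] using hpq x 1
  rw [(hθ f n p q hpq).2, hf1, map_sum]
  refine Finset.sum_congr rfl fun i _ => ?_
  rw [hθinv _ (hq i), map_smul, mul_comm, Algebra.smul_def]

end IsAffineAlgebraicGroup

theorem tmul_one_eq_one_tmul_of_forall_algHom {k S : Type*} [CommRing k] [CommRing S]
    [Algebra k S] {B : Subalgebra k S} {f : S}
    (h : ∀ i₁ i₂ : S →ₐ[k] S ⊗[B] S, (∀ q ∈ B, i₁ q = i₂ q) → i₁ f = i₂ f) :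
    f ⊗ₜ[B] (1 : S) = 1 ⊗ₜ f :=
  h ((Algebra.TensorProduct.includeLeft : S →ₐ[B] S ⊗[B] S).restrictScalars k)
    ((Algebra.TensorProduct.includeRight : S →ₐ[B] S ⊗[B] S).restrictScalars k)
    fun q hq => Algebra.TensorProduct.tmul_one_eq_one_tmul (A := S) (B := S) (⟨q, hq⟩ : B)

theorem IsObservable.exists_descent_subalgebra (hobs : IsObservable A H)
    (hA : IsAffineAlgebraicGroup A) :
    ∃ B : Subalgebra k A, B.FG ∧ B ≤ invariantFunctions A H ∧
      (∀ g, ∀ f ∈ B, hA.leftTranslate g f ∈ B) ∧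
      ∀ f ∈ invariantFunctions A H, f ⊗ₜ[B] (1 : A) = 1 ⊗ₜ f := by
  obtain ⟨F, hFfin, hFinv, hFH, b, hbinv, hb1, hgen⟩ := hobs.exists_local_generators hA
  obtain ⟨V, hVfin, hVstab, hFV, hVmin⟩ :=
    hA.isRationalRepresentation_leftRegular.exists_stable_finiteDimensional (hFfin.insert b)
  have hVinv : V ≤ Subalgebra.toSubmodule (invariantFunctions A H) :=
    hVmin _ (Set.insert_subset hbinv hFinv) fun g f hf =>
      hA.leftTranslate_mem_invariantFunctions g⁻¹ hf
  have hBstab (g) : Algebra.adjoin k (V : Set A) ≤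
      (Algebra.adjoin k (V : Set A)).comap (hA.leftTranslate g) :=
    Algebra.adjoin_le fun f hf => Algebra.subset_adjoin (by
      simpa [IsAffineAlgebraicGroup.leftRegular] using hVstab g⁻¹ hf)
  refine ⟨Algebra.adjoin k V, ?_, Algebra.adjoin_le hVinv, hBstab, fun f hf =>
    tmul_one_eq_one_tmul_of_forall_algHom fun i₁ i₂ hi =>
      hA.algHom_eqOn_invariantFunctions hBstab (fun f hf => ?_) hFH ?_ hb1 hgen hi hf⟩
  · obtain ⟨S, rfl⟩ := Module.Finite.iff_fg.1 hVfin
    exact ⟨S, (Algebra.adjoin_span k).symm⟩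
  · exact Algebra.subset_adjoin (hFV (Set.mem_insert_of_mem _ hf))
  · exact Algebra.subset_adjoin (hFV (Set.mem_insert b F))

end Descent

section GenericDescent

open scoped TensorProduct

variable {k R S : Type*} [Field k] [CommRing R] [CommRing S] [Algebra k R] [Algebra R S]
  [Algebra k S] [IsScalarTower k R S] [IsReduced R]

theorem exists_forall_smul_mem_one_of_fg {p : Ideal R} (hp : p ∈ minimalPrimes R)
    {E : Submodule k S} (hE : E.FG) (hdesc : ∀ f ∈ E, f ⊗ₜ[R] (1 : S) = 1 ⊗ₜ f) :
    ∃ s ∉ p, ∀ f ∈ E, s • f ∈ (1 : Submodule R S) := by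
  have := hp.1.1
  induction E, hE using Submodule.fg_induction with
  | singleton f =>
    obtain ⟨s, hsp, hs⟩ :=
      exists_smul_mem_range_of_tmul_one_eq hp (hdesc f (Submodule.mem_span_singleton_self f))
    refine ⟨s, hsp, fun e he => ?_⟩
    obtain ⟨a, rfl⟩ := Submodule.mem_span_singleton.1 he
    rw [smul_comm, ← algebraMap_smul R a]
    exact Submodule.smul_mem _ _ (Submodule.mem_one.2 hs)
  | sup E₁ E₂ _ _ ih₁ ih₂ =>
    obtain ⟨s₁, hs₁p, hs₁⟩ := ih₁ fun f hf => hdesc f (Submodule.mem_sup_left hf)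
    obtain ⟨s₂, hs₂p, hs₂⟩ := ih₂ fun f hf => hdesc f (Submodule.mem_sup_right hf)
    refine ⟨s₁ * s₂, p.primeCompl.mul_mem hs₁p hs₂p, fun e he => ?_⟩
    obtain ⟨e₁, he₁, e₂, he₂, rfl⟩ := Submodule.mem_sup.1 he
    rw [smul_add, mul_comm, mul_smul, mul_comm, mul_smul]
    exact Submodule.add_mem _ (Submodule.smul_mem _ s₂ (hs₁ e₁ he₁))
      (Submodule.smul_mem _ s₁ (hs₂ e₂ he₂))

theorem exists_ne_zero_forall_mul_mem_of_fg {k S : Type*} [Field k] [CommRing S] [IsReduced S]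
    [Nontrivial S] [Algebra k S] {B : Subalgebra k S} {E : Submodule k S} (hE : E.FG)
    (hdesc : ∀ f ∈ E, f ⊗ₜ[B] (1 : S) = 1 ⊗ₜ f) : ∃ t ∈ B, t ≠ 0 ∧ ∀ f ∈ E, t * f ∈ B := by
  have : IsReduced B := isReduced_of_injective B.val Subtype.val_injective
  obtain ⟨p, hp⟩ := Ideal.nonempty_minimalPrimes (bot_ne_top (α := Ideal B))
  obtain ⟨t, htp, ht⟩ := exists_forall_smul_mem_one_of_fg hp hE hdesc
  refine ⟨t, t.2, fun h => htp ?_, fun f hf => ?_⟩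
  · rw [show t = 0 from Subtype.ext h]
    exact p.zero_mem
  · obtain ⟨r, hr⟩ := Submodule.mem_one.1 (ht f hf)
    exact (congrArg (· ∈ B) hr).mp r.2

theorem exists_ne_zero_forall_algHom_extension [IsAlgClosed k] [Nontrivial R]
    [Algebra.FiniteType k R] [Algebra.FiniteType k S]
    (hinj : Function.Injective (algebraMap R S)) :
    ∃ s : R, s ≠ 0 ∧ ∀ y : R →ₐ[k] k, y s ≠ 0 →
      ∃ ψ : S →ₐ[k] k, ψ.comp (IsScalarTower.toAlgHom k R S) = y := by
  have : IsNoetherianRing R := Algebra.FiniteType.isNoetherianRing k R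
  have : Algebra.FiniteType R S := Algebra.FiniteType.of_restrictScalars_finiteType k R S
  have : Algebra.FinitePresentation R S := Algebra.FinitePresentation.of_finiteType.1 this
  obtain ⟨p, hp⟩ := Ideal.nonempty_minimalPrimes (bot_ne_top (α := Ideal R))
  obtain ⟨s, hsp, hs⟩ := exists_basicOpen_subset_range_comap hp hinj
  refine ⟨s, fun h => hsp (h ▸ p.zero_mem), fun y hy => ?_⟩
  obtain ⟨q, hq⟩ := hs (show ⟨RingHom.ker y, RingHom.ker_isPrime _⟩ ∈ PrimeSpectrum.basicOpen s
    from hy)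
  obtain ⟨m, hm, hqm⟩ := Ideal.exists_le_maximal q.asIdeal q.2.ne_top
  obtain ⟨ψ, rfl⟩ := exists_algHom_ker_eq (k := k) m
  refine ⟨ψ, AlgHom.ext fun r => ?_⟩
  have hr : r - algebraMap k R (y r) ∈ q.asIdeal.comap (algebraMap R S) := by
    rw [show q.asIdeal.comap (algebraMap R S) = RingHom.ker y from
      congrArg PrimeSpectrum.asIdeal hq]
    simp [RingHom.mem_ker]
  have hψ : ψ (algebraMap R S (r - algebraMap k R (y r))) = 0 := hqm hr
  rw [map_sub, ← IsScalarTower.algebraMap_apply, map_sub, AlgHom.commutes] at hψ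
  exact sub_eq_zero.1 hψ

end GenericDescent

section Translates

open scoped TensorProduct

variable {k : Type u} [Field k] {G : Type v} [Group G] {A : Subalgebra k (G → k)} {H : Subgroup G}

theorem isReduced_of_subalgebra_pi {X : Type*} (A : Subalgebra k (X → k)) : IsReduced A :=
  isReduced_of_injective A.val Subtype.val_injective

namespace IsAffineAlgebraicGroup

variable (hA : IsAffineAlgebraicGroup A)

theorem exists_leftTranslate_apply_ne_zero {t : A} (ht : t ≠ 0) (x : G) :
    ∃ g, (hA.leftTranslate g t).1 x ≠ 0 := by
  obtain ⟨y, hy⟩ := Function.ne_iff.1 fun h => ht (Subtype.ext h)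
  exact ⟨y * x⁻¹, by simpa using hy⟩

theorem leftTranslate_leftTranslate_inv (g : G) (f : A) :
    hA.leftTranslate g (hA.leftTranslate g⁻¹ f) = f := by
  ext x
  simp

variable {B : Subalgebra k A} (hBstab : ∀ g, ∀ f ∈ B, hA.leftTranslate g f ∈ B)
include hBstab

theorem exists_mul_mem_of_tmul_one_eq
    (hdesc : ∀ f ∈ invariantFunctions A H, f ⊗ₜ[B] (1 : A) = 1 ⊗ₜ f)
    {f : A} (hf : f ∈ invariantFunctions A H) (x : G) : ∃ c ∈ B, c.1 x ≠ 0 ∧ c * f ∈ B := by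
  obtain ⟨E, hEfin, hEstab, hfE, hEmin⟩ :=
    hA.isRationalRepresentation_leftRegular.exists_stable_finiteDimensional
      (Set.finite_singleton f)
  have hEinv : E ≤ Subalgebra.toSubmodule (invariantFunctions A H) :=
    hEmin _ (Set.singleton_subset_iff.2 hf) fun g f hf =>
      hA.leftTranslate_mem_invariantFunctions g⁻¹ hf
  have := isReduced_of_subalgebra_pi A
  obtain ⟨t, htB, ht0, ht⟩ := exists_ne_zero_forall_mul_mem_of_fg (Module.Finite.iff_fg.1 hEfin)
    fun e he => hdesc e (hEinv he)
  obtain ⟨g, hg⟩ := hA.exists_leftTranslate_apply_ne_zero ht0 x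
  refine ⟨hA.leftTranslate g t, hBstab g t htB, hg, ?_⟩
  rw [← hA.leftTranslate_leftTranslate_inv g f, ← map_mul]
  exact hBstab g _ (ht _ (hEstab g (hfE rfl)))

theorem exists_ne_zero_forall_algHom_eq_eval [IsAlgClosed k] (hB : B.FG) (x : G) :
    ∃ b : B, b.1.1 x ≠ 0 ∧ ∀ y : B →ₐ[k] k, y b ≠ 0 → ∃ x' : G, ∀ f : B, y f = f.1.1 x' := by
  have := isReduced_of_subalgebra_pi A
  have : IsReduced B := isReduced_of_injective B.val Subtype.val_injective
  have : Algebra.FiniteType k A := A.fg_iff_finiteType.mp hA.fg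
  have : Algebra.FiniteType k B := B.fg_iff_finiteType.mp hB
  obtain ⟨s, hs0, hs⟩ := exists_ne_zero_forall_algHom_extension (k := k) (R := B) (S := A)
    Subtype.val_injective
  obtain ⟨g, hg⟩ := hA.exists_leftTranslate_apply_ne_zero (fun h => hs0 (Subtype.ext h)) x
  let L (g : G) : B →ₐ[k] B :=
    ((hA.leftTranslate g).comp B.val).codRestrict B fun f => hBstab g f.1 f.2
  refine ⟨L g s, hg, fun y hy => ?_⟩
  obtain ⟨ψ, hψ⟩ := hs (y.comp (L g)) hy
  obtain ⟨x', rfl⟩ := hA.eval_bijective.2 ψ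
  refine ⟨g⁻¹ * x', fun f => ?_⟩
  have hLf : L g (L g⁻¹ f) = f := Subtype.ext (hA.leftTranslate_leftTranslate_inv g f.1)
  calc y f = y (L g (L g⁻¹ f)) := by rw [hLf]
    _ = f.1.1 (g⁻¹ * x') := (DFunLike.congr_fun hψ (L g⁻¹ f)).symm

end IsAffineAlgebraicGroup

end Translates

section MaximalSpectrum

theorem exists_isAffineVariety_of_finiteType {k : Type u} [Field k] {R : Type v} [CommRing R]
    [Algebra k R] [Algebra.FiniteType k R] :
    ∃ (Y : Type u) (e : (R →ₐ[k] k) ≃ Y) (Φ : R →ₐ[k] (Y → k)),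
      (∀ r y, Φ r (e y) = y r) ∧ IsAffineVariety Φ.range := by
  obtain ⟨n, π, hπ⟩ := Algebra.FiniteType.iff_quotient_mvPolynomial''.1 ‹Algebra.FiniteType k R›
  have : Small.{u} (R →ₐ[k] k) := by
    refine small_of_injective (β := Fin n → k) (f := fun y i => y (π (MvPolynomial.X i)))
      fun y y' h => ?_
    have hπy : y.comp π = y'.comp π := MvPolynomial.algHom_ext fun i => congrFun h i
    exact (AlgHom.cancel_right hπ).1 hπy
  let e := equivShrink.{u} (R →ₐ[k] k)
  let Φ : R →ₐ[k] (Shrink.{u} (R →ₐ[k] k) → k) := AlgHom.pi fun y => e.symm y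
  have hΦ (r y) : Φ r (e y) = y r := congrArg (· r) (e.symm_apply_apply y)
  refine ⟨_, e, Φ, hΦ, ?_, fun y y' h => ?_, fun ψ => ?_⟩
  · rw [Subalgebra.fg_iff_finiteType]
    exact Algebra.FiniteType.of_surjective Φ.rangeRestrict Φ.rangeRestrict_surjective
  · exact e.symm.injective (AlgHom.ext fun r => DFunLike.congr_fun h (Φ.rangeRestrict r))
  · refine ⟨e (ψ.comp Φ.rangeRestrict), AlgHom.ext fun f => ?_⟩
    obtain ⟨r, rfl⟩ := Φ.rangeRestrict_surjective f
    exact hΦ r _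

end MaximalSpectrum

section ImmersionCriterion

variable {k : Type u} [Field k] {G : Type v} [Group G] {A : Subalgebra k (G → k)} {H : Subgroup G}

theorem isOpen_compl_singleton_cosetMk (hA : IsAffineAlgebraicGroup A)
    (hH : IsClosed[zariskiTopology A] (H : Set G)) (x : G) :
    IsOpen ({cosetMk A H x}ᶜ : Set (homogeneousSpace A H).carrier) := by
  let := zariskiTopology A
  rw [isOpen_homogeneousSpace_iff, isOpen_zariskiTopology_iff]
  intro z hz
  obtain ⟨f, hf, hfz, hfH⟩ := isOpen_zariskiTopology_iff.1 hH.isOpen_compl (x⁻¹ * z)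
    fun h => hz (cosetMk_eq_iff.2 h).symm
  exact ⟨_, hA.mul_left_mem x⁻¹ _ hf, hfz, fun y hy hxy =>
    hfH _ hy (cosetMk_eq_iff.1 (Eq.symm hxy))⟩

variable {Y : Type w} {C : Subalgebra k (Y → k)} {φ : (homogeneousSpace A H).carrier → Y}

variable (C φ) in
/-- Every invariant polynomial function on `G` is, locally on `G/H`, a fraction of functions in `C`
pulled back along `φ : G/H → Y`. -/
def InvariantsAreFractions : Prop :=
  ∀ f ∈ invariantFunctions A H, ∀ x, ∃ c ∈ C, ∃ g ∈ C, c (φ (cosetMk A H x)) ≠ 0 ∧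
    ∀ y, c (φ (cosetMk A H y)) * f.1 y = g (φ (cosetMk A H y))

theorem InvariantsSeparate.exists_comp_ne_zero (hsep : InvariantsSeparate A H)
    (hfrac : InvariantsAreFractions C φ) {U : Set (homogeneousSpace A H).carrier} (hU : IsOpen U)
    {x : G} (hx : cosetMk A H x ∈ U) :
    ∃ b ∈ C, b (φ (cosetMk A H x)) ≠ 0 ∧ ∀ q, b (φ q) ≠ 0 → q ∈ U := by
  obtain ⟨f, hf, hfx, hfU⟩ := hsep U hU x hx
  obtain ⟨c, -, g, hg, hcx, hcf⟩ := hfrac f hf x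
  refine ⟨g, hg, hcf x ▸ mul_ne_zero hcx hfx, fun q hq => ?_⟩
  obtain ⟨y, rfl⟩ := cosetMk_surjective q
  exact hfU y (right_ne_zero_of_mul (hcf y ▸ hq))

theorem InvariantsSeparate.injective_of_fractions (hsep : InvariantsSeparate A H)
    (hA : IsAffineAlgebraicGroup A) (hH : IsClosed[zariskiTopology A] (H : Set G))
    (hfrac : InvariantsAreFractions C φ) : Function.Injective φ := by
  intro q q' hqq'
  obtain ⟨x, rfl⟩ := cosetMk_surjective q
  obtain ⟨x', rfl⟩ := cosetMk_surjective q'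
  by_contra hne
  obtain ⟨b, -, hbx, hb⟩ := hsep.exists_comp_ne_zero hfrac
    (isOpen_compl_singleton_cosetMk hA hH x') hne
  exact hb _ (hqq' ▸ hbx) rfl

theorem InvariantsSeparate.isOpen_image_of_fractions (hsep : InvariantsSeparate A H)
    (hfrac : InvariantsAreFractions C φ)
    (hrange : ∀ x, ∃ b ∈ C, b (φ (cosetMk A H x)) ≠ 0 ∧ ∀ y, b y ≠ 0 → y ∈ Set.range φ)
    {U : Set (homogeneousSpace A H).carrier} (hU : IsOpen U) :
    IsOpen[zariskiTopology C] (φ '' U) := by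
  rw [isOpen_zariskiTopology_iff]
  rintro _ ⟨q, hq, rfl⟩
  obtain ⟨x, rfl⟩ := cosetMk_surjective q
  obtain ⟨c, hc, hcx, hcU⟩ := hsep.exists_comp_ne_zero hfrac hU hq
  obtain ⟨b, hb, hbx, hbφ⟩ := hrange x
  refine ⟨b * c, C.mul_mem hb hc, mul_ne_zero hbx hcx, fun y hy => ?_⟩
  obtain ⟨q, rfl⟩ := hbφ y (left_ne_zero_of_mul hy)
  exact ⟨q, hcU q (right_ne_zero_of_mul hy), rfl⟩

variable (hφ : ∀ b ∈ C, (fun x => b (φ (cosetMk A H x))) ∈ A)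
include hφ

theorem continuous_of_comp_cosetMk_mem : Continuous[_, zariskiTopology C] φ := by
  refine continuous_generateFrom_iff.2 ?_
  rintro _ ⟨b, hb, rfl⟩
  exact isOpen_homogeneousSpace_iff.2 (isOpen_zariskiTopology_ne_zero (hφ b hb))

theorem IsRegularOn.comp_cosetMk {V : Set Y} {f : V → k} (hf : IsRegularOn C V f) :
    IsRegularOn A (cosetMk A H ⁻¹' (φ ⁻¹' V)) fun x => f ⟨φ (cosetMk A H x), x.2⟩ := by
  intro x
  obtain ⟨g, hg, d, hd, hdx, h⟩ := hf ⟨_, x.2⟩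
  exact ⟨_, hφ g hg, _, hφ d hd, hdx, fun y => h ⟨_, y.2⟩⟩

theorem IsRegularOn.of_comp_cosetMk [IsAlgClosed k] (hA : IsAffineVariety A)
    (hfrac : InvariantsAreFractions C φ) {V : Set Y} (hV : IsOpen[zariskiTopology C] V)
    (hVφ : V ⊆ Set.range φ) {f : V → k} (hf : IsRegularOn A (cosetMk A H ⁻¹' (φ ⁻¹' V))
      fun x => f ⟨φ (cosetMk A H x), x.2⟩) : IsRegularOn C V f := by
  rintro ⟨y, hy⟩
  obtain ⟨q, rfl⟩ := hVφ hy
  obtain ⟨x, rfl⟩ := cosetMk_surjective q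
  obtain ⟨c, hc, hcx, hcV⟩ := isOpen_zariskiTopology_iff.1 hV _ hy
  obtain ⟨n, g, hg⟩ := hA.exists_pow_mul_eq hf (c := ⟨_, hφ c hc⟩) fun z hz => hcV _ hz
  let cg : A := ⟨_, hφ c hc⟩ * g
  have hcg (z) (hz : φ (cosetMk A H z) ∈ V) :
      cg.1 z = c (φ (cosetMk A H z)) ^ (n + 1) * f ⟨_, hz⟩ := by
    rw [pow_succ', mul_assoc]
    exact congrArg (c (φ (cosetMk A H z)) * ·) (hg ⟨z, hz⟩).symm
  -- `c` vanishes outside `V`, so `c * g` is invariant on all of `G`.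
  have hcginv : cg ∈ invariantFunctions A H := by
    intro z h
    by_cases hz : φ (cosetMk A H z) ∈ V
    · rw [hcg z hz, hcg (z * h) (by rwa [cosetMk_mul])]
      simp only [cosetMk_mul]
    · have hcz : c (φ (cosetMk A H z)) = 0 := by_contra fun h => hz (hcV _ h)
      simp [cg, hcz]
  obtain ⟨b, hb, β, hβ, hbx, hbβ⟩ := hfrac cg hcginv x
  refine ⟨β, hβ, b * c ^ (n + 1), C.mul_mem hb (C.pow_mem hc _),
    mul_ne_zero hbx (pow_ne_zero _ hcx), ?_⟩
  rintro ⟨_, hy⟩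
  obtain ⟨q, rfl⟩ := hVφ hy
  obtain ⟨z, rfl⟩ := cosetMk_surjective q
  rw [← hbβ z, hcg z hy, ← mul_assoc]
  rfl

theorem InvariantsSeparate.exists_isOpenImmersion [IsAlgClosed k] (hsep : InvariantsSeparate A H)
    (hA : IsAffineAlgebraicGroup A) (hH : IsClosed[zariskiTopology A] (H : Set G))
    (hfrac : InvariantsAreFractions C φ)
    (hrange : ∀ x, ∃ b ∈ C, b (φ (cosetMk A H x)) ≠ 0 ∧ ∀ y, b y ≠ 0 → y ∈ Set.range φ) :
    ∃ ψ, (homogeneousSpace A H).IsOpenImmersion (SpaceWithFunctions.ofAffine C) ψ := by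
  refine ⟨⟨φ, continuous_of_comp_cosetMk_mem hφ⟩, .of_continuous_injective_isOpenMap
    (continuous_of_comp_cosetMk_mem hφ) (hsep.injective_of_fractions hA hH hfrac)
    fun U hU => hsep.isOpen_image_of_fractions hfrac hrange hU, fun V hV f => ?_⟩
  rw [mem_regular_ofAffine_iff, mem_regular_homogeneousSpace_iff]
  exact ⟨fun hf => hf.comp_cosetMk hφ,
    fun hf => .of_comp_cosetMk hφ hA.toIsAffineVariety hfrac V.2 hV hf⟩

end ImmersionCriterion

section QuasiAffine

variable {k : Type u} [Field k] {G : Type v} [Group G] {A : Subalgebra k (G → k)} {H : Subgroup G}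

theorem IsObservable.isQuasiAffine [IsAlgClosed k] (hobs : IsObservable A H)
    (hA : IsAffineAlgebraicGroup A) (hH : IsClosed[zariskiTopology A] (H : Set G)) :
    (homogeneousSpace A H).IsQuasiAffine := by
  obtain ⟨B, hBfg, hBinv, hBstab, hdesc⟩ := hobs.exists_descent_subalgebra hA
  have : Algebra.FiniteType k B := B.fg_iff_finiteType.mp hBfg
  obtain ⟨Y, e, Φ, hΦ, hY⟩ := exists_isAffineVariety_of_finiteType (k := k) (R := B)
  let ev (x : G) : B →ₐ[k] k := (Pi.evalAlgHom k (fun _ : G => k) x).comp (A.val.comp B.val)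
  let φ : (homogeneousSpace A H).carrier → Y := Quotient.lift (fun x => e (ev x))
      fun (x y : G) hxy => by
    refine congrArg e (AlgHom.ext fun b => ?_)
    simpa [ev] using (hBinv b.2 x ⟨x⁻¹ * y, QuotientGroup.leftRel_apply.1 hxy⟩).symm
  have hφ (b : B) (x : G) : Φ b (φ (cosetMk A H x)) = b.1.1 x := hΦ b (ev x)
  refine ⟨Y, Φ.range, hY, (hobs.invariantsSeparate hA).exists_isOpenImmersion (φ := φ) ?_ hA hH
    (fun f hf x => ?_) fun x => ?_⟩
  · rintro _ ⟨b, rfl⟩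
    exact (funext (hφ b) : _ = b.1.1) ▸ b.1.2
  · obtain ⟨c, hc, hcx, hcf⟩ := hA.exists_mul_mem_of_tmul_one_eq hBstab hdesc hf x
    refine ⟨Φ ⟨c, hc⟩, ⟨_, rfl⟩, Φ ⟨c * f, hcf⟩, ⟨_, rfl⟩, (hφ _ x).trans_ne hcx, fun z => ?_⟩
    rw [hφ, hφ]
    rfl
  · obtain ⟨b, hbx, hb⟩ := hA.exists_ne_zero_forall_algHom_eq_eval hBstab hBfg x
    refine ⟨Φ b, ⟨b, rfl⟩, (hφ b x).trans_ne hbx, fun y hy => ?_⟩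
    obtain ⟨ψ, rfl⟩ := e.surjective y
    obtain ⟨x', hx'⟩ := hb ψ (hΦ b ψ ▸ hy)
    exact ⟨cosetMk A H x', congrArg e (AlgHom.ext fun f => (hx' f).symm)⟩

end QuasiAffine

theorem theorem3p1 {k : Type u} [Field k] [IsAlgClosed k] {G : Type v} [Group G]
    (A : Subalgebra k (G → k)) (hA : IsAffineAlgebraicGroup A)
    (H : Subgroup G) (hH : @IsClosed G (zariskiTopology A) (H : Set G)) :
    IsObservable A H ↔ (homogeneousSpace A H).IsQuasiAffine :=
  ⟨fun hobs => hobs.isQuasiAffine hA hH,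
    fun hq => (hq.invariantsSeparate hA.toIsAffineVariety).isObservable hA⟩
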